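/- Consider linear models $\mathbf y=\mathbf X\boldsymbol\beta+\boldsymbol\varepsilon$ indexed by the sample size $n$, where $\mathbf y=(Y_1,\dots,Y_n)^T$, $\mathbf X=(X_{ij})$ is a random $n\times p$ design matrix with rows $\mathbf x_i^T$, $p=p_n$ and $\boldsymbol\beta=\boldsymbol\beta_n\in\mathbb R^{p}$ is deterministic with $s=s_n=\#\{j:\beta_j\neq0\}$. For an index set $M$ let $\mathbf X_M$ be the submatrix of the columns indexed by $M$, and let $$\phi_{\min}(m)=\min_{|M|\le m}\lambda_{\min}\big(\tfrac1n\mathbf X_M^T\mathbf X_M\big),\qquad \phi_{\max}(m)=\max_{|M|\le m}\lambda_{\max}\big(\tfrac1n\mathbf X_M^T\mathbf X_M\big)$$ (over nonempty $M$; a minimum over no sets is $+\infty$, a maximum over no sets is $0$). Assume: (A1) $\varepsilon_1,\dots,\varepsilon_n$ are i.i.d. with a law that does not depend on $n$, with mean zero and finite variance $\sigma^2$, and are independent of $\mathbf X$. (A2) There are a constant $\lambda_0>0$ and integers $b_n\ge0$ with $b_n/n\to0$ such that $P\{\phi_{\min}(b_n)\ge\lambda_0\}=1$ for all $n\ge1$.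 (A3) There is a constant $L$ such that, almost surely, $\max_{i,j}|X_{ij}|\le L$ for all $n$. (A4) $E\exp(|\varepsilon_1|/a)\le b$ for some finite constants $a,b>0$. (A7) There are constants $0<k_{\min}\le k_{\max}<\infty$ such that $$P\big\{\liminf_{n\to\infty}\phi_{\min}(s\log n)\ge k_{\min}\big\}=1,\qquad P\big\{\limsup_{n\to\infty}\phi_{\max}(s+\min\{n,p\})\le k_{\max}\big\}=1 .$$ Assume also that $s=o(n^{\alpha_0})$ for some $\alpha_0<1$. Let $\hat{\boldsymbol\beta}_L$ be any measurable choice of a minimizer of $$\frac1n\sum_{i=1}^n(Y_i-\mathbf x_i^T\mathbf b)^2+\lambda_n\|\mathbf b\|_1\quad(\mathbf b\in\mathbb R^p),\qquad \lambda_n=c\,\sigma\sqrt{\log p/n},$$ let $\hat s_L$ be the number of nonzero coordinates of $\hat{\boldsymbol\beta}_L$, and let $$\hat\sigma_L^2=\frac1{n-\hat s_L}\sum_{i=1}^n(Y_i-\mathbf x_i^T\hat{\boldsymbol\beta}_L)^2 .$$ Then there is a constant $C_0>0$, depending only on the law of the errors and on the constants $a,b,L,k_{\min},k_{\max}$, such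 that for every fixed $c\ge C_0$: $$\hat\sigma_L^2-\sigma^2=O_P\big(\max(n^{-1/2},\,s\log p/n)\big);$$ and if moreover $s\log p/\sqrt n\to0$, then $$\sqrt n\,(\hat\sigma_L^2-\sigma^2)\to N\big(0,\;E[\varepsilon_1^4]-\sigma^4\big)\quad\text{in distribution.}$$ -/

import Mathlib

open MeasureTheory ProbabilityTheory Filter Topology Asymptotics
open scoped ENNReal

noncomputable section

/-- The normalized Gram matrix `n⁻¹ X_Mᵀ X_M` of the columns of `X` indexed by `M`. -/
def subGram {n p : ℕ} (X : Matrix (Fin n) (Fin p) ℝ) (M : Finset (Fin p)) :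
    Matrix {j // j ∈ M} {j // j ∈ M} ℝ :=
  (1 / (n : ℝ)) •
    ((X.submatrix id (Subtype.val : {j // j ∈ M} → Fin p)).transpose *
      X.submatrix id (Subtype.val : {j // j ∈ M} → Fin p))

/-- The sparse minimal eigenvalue `φ_min(m)`: the smallest eigenvalue of `n⁻¹ X_Mᵀ X_M`, minimized
over the index sets `M` with `|M| ≤ m`. The eigenvalues are nonnegative, so the value is taken in
`[0, ∞]`; the empty index set has no eigenvalue and does not count. -/
def phiMin {n p : ℕ} (X : Matrix (Fin n) (Fin p) ℝ) (m : ℝ) : ℝ≥0∞ :=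
  ⨅ (M : Finset (Fin p)) (_ : (M.card : ℝ) ≤ m) (κ ∈ spectrum ℝ (subGram X M)), ENNReal.ofReal κ

/-- The sparse maximal eigenvalue `φ_max(m)`: the largest eigenvalue of `n⁻¹ X_Mᵀ X_M`, maximized
over the index sets `M` with `|M| ≤ m`. -/
def phiMax {n p : ℕ} (X : Matrix (Fin n) (Fin p) ℝ) (m : ℝ) : ℝ≥0∞ :=
  ⨆ (M : Finset (Fin p)) (_ : (M.card : ℝ) ≤ m) (κ ∈ spectrum ℝ (subGram X M)), ENNReal.ofReal κ

/-- The number of nonzero coordinates of a vector. -/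
def numNonzero {p : ℕ} (v : Fin p → ℝ) : ℕ :=
  (Finset.univ.filter fun j => v j ≠ 0).card

/-- The residual sum of squares `∑ i, (y_i - x_iᵀ v)²`. -/
def residualSS {n p : ℕ} (X : Matrix (Fin n) (Fin p) ℝ) (y : Fin n → ℝ) (v : Fin p → ℝ) : ℝ :=
  ∑ i, (y i - (X.mulVec v) i) ^ 2

/-- The LASSO criterion `n⁻¹ ∑ i, (y_i - x_iᵀ v)² + lam * ‖v‖₁`. -/
def lassoObjective {n p : ℕ} (X : Matrix (Fin n) (Fin p) ℝ) (y : Fin n → ℝ) (lam : ℝ)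
    (v : Fin p → ℝ) : ℝ :=
  (1 / (n : ℝ)) * residualSS X y v + lam * ∑ j, |v j|

/-- `v` is a LASSO estimate: a global minimizer of the LASSO criterion. -/
def IsLasso {n p : ℕ} (X : Matrix (Fin n) (Fin p) ℝ) (y : Fin n → ℝ) (lam : ℝ)
    (v : Fin p → ℝ) : Prop :=
  ∀ w : Fin p → ℝ, lassoObjective X y lam v ≤ lassoObjective X y lam w

/-- The plug-in variance estimator `(n - ŝ)⁻¹ ∑ i, (y_i - x_iᵀ v)²`, where `ŝ` is the number of
nonzero coordinates of the estimate `v`. -/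
def plugInVariance {n p : ℕ} (X : Matrix (Fin n) (Fin p) ℝ) (y : Fin n → ℝ)
    (v : Fin p → ℝ) : ℝ :=
  (1 / ((n : ℝ) - (numNonzero v : ℝ))) * residualSS X y v

/-- `Z n = O_P(r n)`: for every `δ > 0` there is a constant `C` such that, for all large `n`,
`|Z n| > C * r n` has probability at most `δ`. -/
def IsBigOInProb {Ω : Type*} [MeasurableSpace Ω] (μ : Measure Ω) (Z : ℕ → Ω → ℝ) (r : ℕ → ℝ) :
    Prop :=
  ∀ δ : ℝ, 0 < δ → ∃ C : ℝ, ∀ᶠ n in atTop, μ {ω | C * r n < |Z n ω|} ≤ ENNReal.ofReal δ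

end

/-! Write `d` for the estimation error and `e` for the errors. The residual sum of squares is `∑ e²
- 2 ⟨e, X d⟩ + ‖X d‖²`, so once the last two terms are `O(s log p)` and the support of the estimate
has size `O(s)`, the plug-in variance is the mean of the `e²` up to a relative error of order `s /
n` and an additive error of order `s log p / n`. Chebyshev's inequality and the central limit
theorem for the mean of the `e²` then give the two claims.

The deterministic core is `lasso_oracle`. If `4 |⟨X_j, e⟩| ≤ n λ` for all `j`, minimality puts `d`
in the cone `‖d_Sᶜ‖₁ ≤ 3 ‖d_S‖₁`; `restricted_eigenvalue` deduces from the sparse eigenvalues that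
`‖X d‖²` is of order `n λ² s`. Each active column has correlation at least `n λ / 4` with `X d`, and
the upper sparse eigenvalue limits how many columns can.

Whether the noise is dominated depends on `p`, which may follow any regime along `n`: if `log n < p`
and `log p ≤ n`, a Chernoff bound and a union over columns fail with probability at most `2 / p`,
which is at most `2 / log n`; if `log p > n`, the penalty is so large that Cauchy–Schwarz and `∑ e²
≤ 2 σ² n` suffice; if `p ≤ log n`, `p` may stay bounded and the union bound is useless. There
`lasso_low_dim` uses the projection of `e` on the column space, whose mean square is at most `σ² p ≤
σ² log n`, hence below `n ^ (1/4)` up to constants with high probability, and this is `o(√n)`.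

When `σ = 0` the penalty vanishes and almost surely all residuals are zero. -/

/-! ### Sparse eigenvalues as bounds on quadratic forms -/

/-- A real symmetric matrix whose spectrum lies above `κ` has a quadratic form above `κ`. -/
theorem Matrix.IsHermitian.le_quadForm {ι : Type*} [Fintype ι] [DecidableEq ι]
    {G : Matrix ι ι ℝ} (hG : G.IsHermitian) {κ : ℝ} (h : ∀ x ∈ spectrum ℝ G, κ ≤ x)
    (w : ι → ℝ) : κ * (w ⬝ᵥ w) ≤ w ⬝ᵥ G.mulVec w := by
  have hH : (G - algebraMap ℝ (Matrix ι ι ℝ) κ).IsHermitian := by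
    refine hG.sub ?_
    rw [Matrix.algebraMap_eq_diagonal]
    exact Matrix.isHermitian_diagonal _
  have hpos : (G - algebraMap ℝ (Matrix ι ι ℝ) κ).PosSemidef := by
    rw [hH.posSemidef_iff_eigenvalues_nonneg]
    intro i
    have h1 := hH.eigenvalues_mem_spectrum_real i
    rw [← spectrum.sub_singleton_eq] at h1
    obtain ⟨x, hx, y, hy, hxy⟩ := h1
    have := h x hx
    simp only [Set.mem_singleton_iff] at hy
    simp only [Pi.zero_apply]
    rw [← hxy, hy]
    simpa using this
  have h2 := hpos.dotProduct_mulVec_nonneg w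
  rw [Matrix.sub_mulVec, dotProduct_sub, Algebra.algebraMap_eq_smul_one, Matrix.smul_mulVec,
    Matrix.one_mulVec, dotProduct_smul] at h2
  simpa using h2

theorem Matrix.IsHermitian.quadForm_le {ι : Type*} [Fintype ι] [DecidableEq ι]
    {G : Matrix ι ι ℝ} (hG : G.IsHermitian) {κ : ℝ} (h : ∀ x ∈ spectrum ℝ G, x ≤ κ)
    (w : ι → ℝ) : w ⬝ᵥ G.mulVec w ≤ κ * (w ⬝ᵥ w) := by
  have h1 := hG.neg.le_quadForm (κ := -κ) (fun x hx => by
    rw [← spectrum.neg_eq, Set.mem_neg] at hx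
    linarith [h _ hx]) w
  rw [Matrix.neg_mulVec, dotProduct_neg] at h1
  linarith

theorem subGram_isHermitian {n p : ℕ} (X : Matrix (Fin n) (Fin p) ℝ) (M : Finset (Fin p)) :
    (subGram X M).IsHermitian := by
  unfold subGram
  rw [Matrix.IsHermitian, Matrix.conjTranspose_smul, Matrix.conjTranspose_mul]
  simp [Matrix.conjTranspose_eq_transpose_of_trivial]

theorem subGram_quadForm {n p : ℕ} (X : Matrix (Fin n) (Fin p) ℝ) (M : Finset (Fin p))
    (v : Fin p → ℝ) (hv : ∀ j, j ∉ M → v j = 0) :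
    (fun j : {j // j ∈ M} => v j) ⬝ᵥ (subGram X M).mulVec (fun j : {j // j ∈ M} => v j) =
      (1 / (n : ℝ)) * ∑ i, (X.mulVec v i) ^ 2 := by
  have hX : (X.submatrix id (Subtype.val : {j // j ∈ M} → Fin p)).mulVec
      (fun j : {j // j ∈ M} => v j) = X.mulVec v := by
    ext i
    simp only [Matrix.mulVec, dotProduct, Matrix.submatrix_apply, id]
    rw [Finset.sum_coe_sort M (fun j => X i j * v j)]
    refine Finset.sum_subset (Finset.subset_univ _) fun j _ hj => ?_
    rw [hv j hj, mul_zero]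
  unfold subGram
  rw [Matrix.smul_mulVec, dotProduct_smul, ← Matrix.mulVec_mulVec, hX,
    Matrix.mulVec_transpose, dotProduct_comm, ← Matrix.dotProduct_mulVec, hX]
  simp [dotProduct, pow_two]

theorem sum_sq_support {p : ℕ} (v : Fin p → ℝ) (M : Finset (Fin p)) (hv : ∀ j, j ∉ M → v j = 0) :
    (fun j : {j // j ∈ M} => v j) ⬝ᵥ (fun j : {j // j ∈ M} => v j) = ∑ j, v j ^ 2 := by
  simp only [dotProduct]
  rw [Finset.sum_coe_sort M (fun j => v j * v j)]
  rw [Finset.sum_subset (Finset.subset_univ M) fun j _ hj => by rw [hv j hj, mul_zero]]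
  simp [pow_two]

/-- The quadratic form of the Gram matrix on sparse vectors is bounded below. -/
def SparseLower {n p : ℕ} (X : Matrix (Fin n) (Fin p) ℝ) (κ m : ℝ) : Prop :=
  ∀ v : Fin p → ℝ, (numNonzero v : ℝ) ≤ m →
    n * κ * ∑ j, v j ^ 2 ≤ ∑ i, (X.mulVec v i) ^ 2

/-- The quadratic form of the Gram matrix on sparse vectors is bounded above. -/
def SparseUpper {n p : ℕ} (X : Matrix (Fin n) (Fin p) ℝ) (κ m : ℝ) : Prop :=
  ∀ v : Fin p → ℝ, (numNonzero v : ℝ) ≤ m →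
    ∑ i, (X.mulVec v i) ^ 2 ≤ n * κ * ∑ j, v j ^ 2

theorem sparseLower_of_le_phiMin {n p : ℕ} (hn : 0 < n) {X : Matrix (Fin n) (Fin p) ℝ} {κ m : ℝ}
    (hκ : 0 < κ) (h : ENNReal.ofReal κ ≤ phiMin X m) : SparseLower X κ m := by
  intro v hv
  set M : Finset (Fin p) := Finset.univ.filter fun j => v j ≠ 0 with hM
  have hvM : ∀ j, j ∉ M → v j = 0 := fun j hj => by simpa [hM] using hj
  have h1 := (subGram_isHermitian X M).le_quadForm (κ := κ) (fun x hx => by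
    have h2 : phiMin X m ≤ ENNReal.ofReal x := by
      unfold phiMin
      exact (iInf_le_of_le M (iInf_le_of_le hv (iInf_le_of_le x (iInf_le _ hx))))
    have h3 := h.trans h2
    by_contra hlt
    push Not at hlt
    -- `ENNReal.ofReal` truncates at zero, so the strict comparison needs `κ > 0`.
    exact absurd ((ENNReal.ofReal_lt_ofReal_iff hκ).2 hlt) (not_lt.2 h3)) (fun j => v j)
  rw [subGram_quadForm X M v hvM, sum_sq_support v M hvM] at h1
  have hn' : (0 : ℝ) < n := by exact_mod_cast hn
  rw [one_div, ← div_eq_inv_mul, le_div_iff₀ hn'] at h1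
  linarith

theorem sparseUpper_of_phiMax_le {n p : ℕ} (hn : 0 < n) {X : Matrix (Fin n) (Fin p) ℝ} {κ m : ℝ}
    (hκ : 0 ≤ κ) (h : phiMax X m ≤ ENNReal.ofReal κ) : SparseUpper X κ m := by
  intro v hv
  set M : Finset (Fin p) := Finset.univ.filter fun j => v j ≠ 0 with hM
  have hvM : ∀ j, j ∉ M → v j = 0 := fun j hj => by simpa [hM] using hj
  have h1 := (subGram_isHermitian X M).quadForm_le (κ := κ) (fun x hx => by
    have h2 : ENNReal.ofReal x ≤ phiMax X m := by
      unfold phiMax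
      exact (le_iSup_of_le M (le_iSup_of_le hv (le_iSup_of_le x (le_iSup_of_le hx le_rfl))))
    exact (ENNReal.ofReal_le_ofReal_iff hκ).1 (h2.trans h)) (fun j => v j)
  rw [subGram_quadForm X M v hvM, sum_sq_support v M hvM] at h1
  have hn' : (0 : ℝ) < n := by exact_mod_cast hn
  rw [one_div, ← div_eq_inv_mul, div_le_iff₀ hn'] at h1
  linarith

theorem sum_mul_mulVec {n p : ℕ} (X : Matrix (Fin n) (Fin p) ℝ) (u : Fin n → ℝ) (v : Fin p → ℝ) :
    ∑ i, u i * X.mulVec v i = ∑ j, v j * ∑ i, X i j * u i := by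
  simp only [Matrix.mulVec, dotProduct, Finset.mul_sum]
  rw [Finset.sum_comm]
  refine Finset.sum_congr rfl fun j _ => Finset.sum_congr rfl fun i _ => by ring

theorem numNonzero_le_card {p : ℕ} {v : Fin p → ℝ} {M : Finset (Fin p)}
    (hv : ∀ j, j ∉ M → v j = 0) : numNonzero v ≤ M.card := by
  refine Finset.card_le_card fun j hj => ?_
  by_contra h
  simp [hv j h] at hj

/-! ### Duality and the restricted eigenvalue -/

/-- The dual form of the upper sparse eigenvalue bound. -/
theorem SparseUpper.sum_sq_le {n p : ℕ} {X : Matrix (Fin n) (Fin p) ℝ} {κ m : ℝ}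
    (hκ : 0 ≤ κ) (h : SparseUpper X κ m) (M : Finset (Fin p)) (hM : (M.card : ℝ) ≤ m) (u : Fin n → ℝ) :
    ∑ j ∈ M, (∑ i, X i j * u i) ^ 2 ≤ n * κ * ∑ i, u i ^ 2 := by
  classical
  -- The test vector is `Xᵀ u` cut down to `M`: then `⟨u, X v⟩ = ‖v‖² = A`, and Cauchy–Schwarz with
  -- the sparse bound for `‖X v‖²` gives `A² ≤ ‖u‖² n κ A`.
  set v : Fin p → ℝ := fun j => if j ∈ M then ∑ i, X i j * u i else 0 with hv
  have hvM : ∀ j, j ∉ M → v j = 0 := fun j hj => by simp [hv, hj]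
  set A := ∑ j ∈ M, (∑ i, X i j * u i) ^ 2 with hA
  have h1 : ∑ j, v j ^ 2 = A := by
    rw [hA, ← Finset.sum_subset (Finset.subset_univ M) fun j _ hj => by rw [hvM j hj]; simp]
    exact Finset.sum_congr rfl fun j hj => by simp [hv, hj]
  have h2 : ∑ i, u i * X.mulVec v i = A := by
    rw [sum_mul_mulVec, hA,
      ← Finset.sum_subset (Finset.subset_univ M) fun j _ hj => by rw [hvM j hj]; simp]
    exact Finset.sum_congr rfl fun j hj => by simp [hv, hj, pow_two]
  have h3 := Finset.sum_mul_sq_le_sq_mul_sq Finset.univ u (X.mulVec v)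
  have h4 := h v ((Nat.cast_le.2 (numNonzero_le_card hvM)).trans hM)
  rw [h2] at h3
  rw [h1] at h4
  have hU : 0 ≤ ∑ i, u i ^ 2 := Finset.sum_nonneg fun i _ => sq_nonneg _
  have hA0 : 0 ≤ A := Finset.sum_nonneg fun i _ => sq_nonneg _
  rcases hA0.eq_or_lt with h0 | h0
  · rw [← h0]
    positivity
  · have h5 : A * A ≤ A * (n * κ * ∑ i, u i ^ 2) := by
      calc A * A = A ^ 2 := by ring
        _ ≤ _ := h3
        _ ≤ (∑ i, u i ^ 2) * (n * κ * A) := mul_le_mul_of_nonneg_left h4 hU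
        _ = _ := by ring
    exact le_of_mul_le_mul_left h5 h0

/-- If `‖r‖∞ ≤ τ` and `‖r‖₁ ≤ k τ`, then `r` behaves like a `k`-sparse vector with entries `τ`. -/
theorem SparseUpper.sum_sq_mulVec_le_of_spread {n p k : ℕ} {X : Matrix (Fin n) (Fin p) ℝ} {κ : ℝ}
    (hκ : 0 ≤ κ) (hk : 0 < k)
    (h : ∀ M : Finset (Fin p), M.card ≤ k → ∀ u : Fin n → ℝ,
      ∑ j ∈ M, (∑ i, X i j * u i) ^ 2 ≤ n * κ * ∑ i, u i ^ 2)
    {τ : ℝ} (r : Fin p → ℝ) (hτ : ∀ j, |r j| ≤ τ) (h0 : 0 ≤ τ) (hsum : ∑ j, |r j| ≤ k * τ) :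
    ∑ i, (X.mulVec r i) ^ 2 ≤ 4 * k * τ ^ 2 * (n * κ) := by
  classical
  set u : Fin n → ℝ := X.mulVec r with hu
  set Q := ∑ i, u i ^ 2 with hQ
  have hQ0 : 0 ≤ Q := Finset.sum_nonneg fun i _ => sq_nonneg _
  set g : Fin p → ℝ := fun j => ∑ i, X i j * u i with hg
  have hkr : (0 : ℝ) < k := by exact_mod_cast hk
  set B := n * κ * Q with hB
  have hB0 : 0 ≤ B := by positivity
  have hQg : Q = ∑ j, r j * g j := by
    rw [hQ, hg, ← sum_mul_mulVec X u r]
    exact Finset.sum_congr rfl fun i _ => by rw [pow_two]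
  -- Split `Q = ⟨r, Xᵀ X r⟩` by the size of the correlations `g`. Large ones number at most `k`,
  -- since `k` of them would violate the dual bound; there `|r| ≤ τ` and Cauchy–Schwarz apply.
  -- Elsewhere `|g j| ≤ √(B / k)` is paired with the `ℓ¹` bound on `r`. Both parts are at most `τ
  -- √(k B)`, and `B` is linear in `Q`.
  set T : Finset (Fin p) := Finset.univ.filter fun j => B < k * g j ^ 2 with hT
  have hTk : T.card ≤ k := by
    by_contra hlt
    push Not at hlt
    obtain ⟨M, hMT, hMk⟩ := Finset.exists_subset_card_eq hlt.le
    have h1 := h M hMk.le u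
    have h2 : ∑ j ∈ M, B < ∑ j ∈ M, k * g j ^ 2 := by
      refine Finset.sum_lt_sum_of_nonempty (Finset.card_pos.1 (by omega)) fun j hj => ?_
      have := hMT hj
      simpa [hT] using this
    rw [Finset.sum_const, nsmul_eq_mul, hMk, ← Finset.mul_sum] at h2
    exact absurd (lt_of_mul_lt_mul_left h2 hkr.le) (not_lt.2 h1)
  set D := √B with hD
  have hD0 : 0 ≤ D := Real.sqrt_nonneg _
  have hDD : D * D = B := Real.mul_self_sqrt hB0
  set K := √(k : ℝ) with hK
  have hK0 : 0 < K := Real.sqrt_pos.2 hkr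
  have hKK : K * K = k := Real.mul_self_sqrt hkr.le
  have hTsum : ∑ j ∈ T, |r j * g j| ≤ τ * (K * D) := by
    have h1 : (∑ j ∈ T, |g j|) ^ 2 ≤ (K * D) ^ 2 := by
      have h2 := sq_sum_le_card_mul_sum_sq (s := T) (f := fun j => |g j|)
      simp only [sq_abs] at h2
      have h3 := h T hTk u
      have h4 : (T.card : ℝ) ≤ k := by exact_mod_cast hTk
      calc _ ≤ (T.card : ℝ) * ∑ j ∈ T, g j ^ 2 := h2
        _ ≤ k * B := mul_le_mul h4 h3 (Finset.sum_nonneg fun _ _ => sq_nonneg _) hkr.le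
        _ = (K * D) ^ 2 := by rw [← hKK, ← hDD]; ring
    have h5 := abs_le_of_sq_le_sq h1 (by positivity)
    calc ∑ j ∈ T, |r j * g j| ≤ ∑ j ∈ T, τ * |g j| := by
          refine Finset.sum_le_sum fun j _ => ?_
          rw [abs_mul]
          exact mul_le_mul_of_nonneg_right (hτ j) (abs_nonneg _)
      _ = τ * ∑ j ∈ T, |g j| := by rw [Finset.mul_sum]
      _ ≤ _ := mul_le_mul_of_nonneg_left ((le_abs_self _).trans h5) h0
  have hTc : ∑ j ∈ Finset.univ \ T, |r j * g j| ≤ τ * (K * D) := by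
    have h1 : ∀ j ∈ Finset.univ \ T, |r j * g j| ≤ |r j| * (D / K) := by
      intro j hj
      have hj' : k * g j ^ 2 ≤ B := by simpa [hT] using hj
      rw [abs_mul]
      refine mul_le_mul_of_nonneg_left ?_ (abs_nonneg _)
      rw [le_div_iff₀ hK0]
      refine abs_le_of_sq_le_sq' (a := |g j| * K) (b := D) ?_ hD0 |>.2
      calc (|g j| * K) ^ 2 = k * g j ^ 2 := by rw [mul_pow, sq_abs, ← hKK]; ring
        _ ≤ B := hj'
        _ = D ^ 2 := by rw [← hDD]; ring
    calc _ ≤ ∑ j ∈ Finset.univ \ T, |r j| * (D / K) := Finset.sum_le_sum h1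
      _ = (∑ j ∈ Finset.univ \ T, |r j|) * (D / K) := by rw [Finset.sum_mul]
      _ ≤ (k * τ) * (D / K) := by
          refine mul_le_mul_of_nonneg_right (le_trans ?_ hsum) (by positivity)
          exact Finset.sum_le_sum_of_subset_of_nonneg (Finset.subset_univ _)
            fun _ _ _ => abs_nonneg _
      _ = τ * (K * D) := by rw [← hKK]; field_simp
  have hQle : Q ≤ 2 * (τ * (K * D)) := by
    calc Q = ∑ j, r j * g j := hQg
      _ ≤ ∑ j, |r j * g j| := Finset.sum_le_sum fun j _ => le_abs_self _
      _ = ∑ j ∈ Finset.univ \ T, |r j * g j| + ∑ j ∈ T, |r j * g j| :=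
          (Finset.sum_sdiff (Finset.subset_univ T)).symm
      _ ≤ _ := by linarith
  have hfin : Q * Q ≤ Q * (4 * k * τ ^ 2 * (n * κ)) := by
    calc Q * Q ≤ (2 * (τ * (K * D))) * (2 * (τ * (K * D))) :=
          mul_le_mul hQle hQle hQ0 (by positivity)
      _ = 4 * τ ^ 2 * (K * K) * (D * D) := by ring
      _ = _ := by rw [hKK, hDD, hB]; ring
  rcases hQ0.eq_or_lt with hz | hz
  · rw [← hz]; positivity
  · exact le_of_mul_le_mul_left hfin hz

/-- Sparse eigenvalue bounds give a restricted eigenvalue bound on the cone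
`‖h_Sᶜ‖₁ ≤ 3 ‖h_S‖₁`. -/
theorem restricted_eigenvalue {n p k : ℕ} {X : Matrix (Fin n) (Fin p) ℝ} {κ₁ κ₂ : ℝ}
    (hκ₂ : 0 ≤ κ₂) (hk : 0 < k) (S : Finset (Fin p))
    (hlow : S.card ≠ 0 → SparseLower X κ₁ (S.card + k))
    (hup : ∀ M : Finset (Fin p), M.card ≤ k → ∀ u : Fin n → ℝ,
      ∑ j ∈ M, (∑ i, X i j * u i) ^ 2 ≤ n * κ₂ * ∑ i, u i ^ 2)
    (hsk : 144 * S.card * κ₂ ≤ k * κ₁) (h : Fin p → ℝ)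
    (hcone : ∑ j ∈ Finset.univ \ S, |h j| ≤ 3 * ∑ j ∈ S, |h j|) :
    n * κ₁ * ∑ j ∈ S, h j ^ 2 ≤ 4 * ∑ i, (X.mulVec h i) ^ 2 := by
  classical
  rcases S.eq_empty_or_nonempty with hS | hS
  · subst hS
    simp only [Finset.sum_empty, mul_zero]
    positivity
  have hkr : (0 : ℝ) < k := by exact_mod_cast hk
  have hc : S.card ≠ 0 := Finset.card_ne_zero.2 hS
  set H := ∑ j ∈ S, h j ^ 2 with hH
  set N := ∑ j ∈ Finset.univ \ S, |h j| with hN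
  have hN0 : 0 ≤ N := Finset.sum_nonneg fun _ _ => abs_nonneg _
  -- With this threshold at most `k` coordinates off `S` exceed `τ`. They join `S` in the sparse
  -- part `a`; the rest, `r`, satisfies the spread condition exactly.
  set τ := N / k with hτ
  have hτ0 : 0 ≤ τ := by positivity
  set r : Fin p → ℝ := fun j => if j ∈ S ∨ τ < |h j| then 0 else h j with hr
  have hrle : ∀ j, |r j| ≤ τ := by
    intro j
    simp only [hr]
    split_ifs with hj
    · simpa using hτ0
    · push Not at hj
      exact hj.2
  have hrsum : ∑ j, |r j| ≤ k * τ := by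
    have : k * τ = N := by rw [hτ]; field_simp
    rw [this, hN, ← Finset.sum_sdiff (Finset.subset_univ S)]
    have hz : ∑ j ∈ S, |r j| = 0 := Finset.sum_eq_zero fun j hj => by simp [hr, hj]
    rw [hz, add_zero]
    refine Finset.sum_le_sum fun j _ => ?_
    simp only [hr]
    split_ifs <;> simp
  have hXr := SparseUpper.sum_sq_mulVec_le_of_spread hκ₂ hk hup r hrle hτ0 hrsum
  set J : Finset (Fin p) := (Finset.univ \ S).filter fun j => τ < |h j| with hJ
  have hJk : J.card ≤ k := by
    by_contra hlt
    push Not at hlt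
    have hne : J.Nonempty := Finset.card_pos.1 (by omega)
    have h1 : ∑ j ∈ J, τ < ∑ j ∈ J, |h j| :=
      Finset.sum_lt_sum_of_nonempty hne fun j hj => (Finset.mem_filter.1 hj).2
    have h2 : ∑ j ∈ J, |h j| ≤ N :=
      Finset.sum_le_sum_of_subset_of_nonneg (Finset.filter_subset _ _) fun _ _ _ => abs_nonneg _
    rw [Finset.sum_const, nsmul_eq_mul] at h1
    have h3 : N = k * τ := by rw [hτ]; field_simp
    have h4 : (k : ℝ) * τ ≤ J.card * τ :=
      mul_le_mul_of_nonneg_right (by exact_mod_cast hlt.le) hτ0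
    linarith
  set a : Fin p → ℝ := fun j => h j - r j with ha
  have haz : ∀ j, j ∉ S ∪ J → a j = 0 := by
    intro j hj
    have hj' : ¬ (j ∈ S ∨ τ < |h j|) := by
      simp only [hJ, Finset.mem_union, Finset.mem_filter, Finset.mem_sdiff, Finset.mem_univ,
        true_and, not_or, not_and] at hj
      rintro (h1 | h1)
      · exact hj.1 h1
      · exact hj.2 hj.1 h1
    simp [ha, hr, hj']
  have hacard : (numNonzero a : ℝ) ≤ S.card + k := by
    have h1 : numNonzero a ≤ S.card + k :=
      (numNonzero_le_card haz).trans ((Finset.card_union_le _ _).trans (by omega))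
    exact_mod_cast h1
  have hXa := hlow hc a hacard
  have haH : H ≤ ∑ j, a j ^ 2 := by
    calc H = ∑ j ∈ S, a j ^ 2 := Finset.sum_congr rfl fun j hj => by simp [ha, hr, hj]
      _ ≤ _ := Finset.sum_le_sum_of_subset_of_nonneg (Finset.subset_univ _)
          fun _ _ _ => sq_nonneg _
  have hH0 : 0 ≤ H := Finset.sum_nonneg fun _ _ => sq_nonneg _
  have hsum : ∑ i, (X.mulVec a i) ^ 2 ≤
      2 * ∑ i, (X.mulVec h i) ^ 2 + 2 * ∑ i, (X.mulVec r i) ^ 2 := by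
    rw [Finset.mul_sum, Finset.mul_sum, ← Finset.sum_add_distrib]
    refine Finset.sum_le_sum fun i _ => ?_
    have : X.mulVec a i = X.mulVec h i - X.mulVec r i := by
      have : a = h - r := rfl
      rw [this, Matrix.mulVec_sub, Pi.sub_apply]
    rw [this]
    nlinarith [sq_nonneg (X.mulVec h i + X.mulVec r i)]
  have hNsq : N ^ 2 ≤ 9 * S.card * H := by
    have h1 := sq_sum_le_card_mul_sum_sq (s := S) (f := fun j => |h j|)
    simp only [sq_abs] at h1
    calc N ^ 2 ≤ (3 * ∑ j ∈ S, |h j|) ^ 2 := pow_le_pow_left₀ hN0 hcone 2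
      _ = 9 * (∑ j ∈ S, |h j|) ^ 2 := by ring
      _ ≤ 9 * (S.card * H) := by linarith
      _ = _ := by ring
  have hn0 : (0 : ℝ) ≤ n := Nat.cast_nonneg n
  have hκ₁ : 0 ≤ κ₁ := by
    have : 0 ≤ k * κ₁ := le_trans (by positivity) hsk
    exact nonneg_of_mul_nonneg_right this hkr
  -- The constant 144 is `4 * 4 * 9`: the spread bound contributes 4 and the cone condition 9. It
  -- makes `2 ‖X r‖²` at most half of `n κ₁ H`, which the left side absorbs.
  have hrb : 4 * ∑ i, (X.mulVec r i) ^ 2 ≤ n * κ₁ * H := by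
    have h1 : (k : ℝ) * τ ^ 2 = N ^ 2 / k := by rw [hτ]; field_simp
    calc 4 * ∑ i, (X.mulVec r i) ^ 2 ≤ 4 * (4 * k * τ ^ 2 * (n * κ₂)) := by linarith
      _ = 16 * (N ^ 2 / k) * (n * κ₂) := by rw [← h1]; ring
      _ ≤ 16 * ((9 * S.card * H) / k) * (n * κ₂) := by gcongr
      _ = n * H * ((144 * S.card * κ₂) / k) := by ring
      _ ≤ n * H * κ₁ := by
          refine mul_le_mul_of_nonneg_left ?_ (by positivity)
          rw [div_le_iff₀ hkr]
          linarith
      _ = _ := by ring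
  have hlast : n * κ₁ * H ≤ n * κ₁ * ∑ j, a j ^ 2 :=
    mul_le_mul_of_nonneg_left haH (by positivity)
  linarith

/-! ### Deterministic analysis of the LASSO -/

theorem residualSS_add {n p : ℕ} (X : Matrix (Fin n) (Fin p) ℝ) (y : Fin n → ℝ)
    (v d : Fin p → ℝ) :
    residualSS X y (v + d) = residualSS X y v - 2 * ∑ i, (y i - X.mulVec v i) * X.mulVec d i +
      ∑ i, (X.mulVec d i) ^ 2 := by
  unfold residualSS
  rw [Finset.mul_sum, ← Finset.sum_sub_distrib, ← Finset.sum_add_distrib]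
  refine Finset.sum_congr rfl fun i _ => ?_
  rw [Matrix.mulVec_add, Pi.add_apply]
  ring

/-- The stationarity condition of the LASSO on the active set. -/
theorem IsLasso.le_abs_corr {n p : ℕ} (hn : 0 < n) {X : Matrix (Fin n) (Fin p) ℝ} {y : Fin n → ℝ}
    {lam : ℝ} {v : Fin p → ℝ} (h : IsLasso X y lam v) {j : Fin p} (hj : v j ≠ 0) :
    n * lam ≤ 2 * |∑ i, X i j * (y i - X.mulVec v i)| := by
  classical
  have hn' : (0 : ℝ) < n := by exact_mod_cast hn
  set g := ∑ i, X i j * (y i - X.mulVec v i) with hg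
  set A := ∑ i, X i j ^ 2 with hA
  have hA0 : 0 ≤ A := Finset.sum_nonneg fun _ _ => sq_nonneg _
  -- Only one competitor is needed: shrink the `j`-th coordinate by the factor `1 - η`. For `η ≤ 1`
  -- its sign is kept, so the penalty drops by exactly `lam * η |v j|`. Letting `η` tend to zero
  -- removes the quadratic term.
  have key : ∀ η : ℝ, 0 < η → η ≤ 1 → n * lam ≤ 2 * |g| + η * (|v j| * A) := by
    intro η hη hη1
    have h1 := h (v + Pi.single j (-(η * v j)))
    have hX : ∀ i, X.mulVec (Pi.single j (-(η * v j))) i = -(η * v j) * X i j := by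
      intro i
      rw [Matrix.mulVec_single]
      simp [mul_comm]
    have hR := residualSS_add X y v (Pi.single j (-(η * v j)))
    have hs1 : ∑ i, (y i - X.mulVec v i) * X.mulVec (Pi.single j (-(η * v j))) i =
        -(η * v j) * g := by
      rw [hg, Finset.mul_sum]
      exact Finset.sum_congr rfl fun i _ => by rw [hX]; ring
    have hs2 : ∑ i, (X.mulVec (Pi.single j (-(η * v j))) i) ^ 2 = (η * v j) ^ 2 * A := by
      rw [hA, Finset.mul_sum]
      exact Finset.sum_congr rfl fun i _ => by rw [hX]; ring
    have hl1 : ∑ l, |(v + (Pi.single j (-(η * v j)) : Fin p → ℝ)) l| = ∑ l, |v l| - η * |v j| := by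
      rw [← Finset.add_sum_erase _ _ (Finset.mem_univ j),
        ← Finset.add_sum_erase (a := j) Finset.univ (fun l => |v l|) (Finset.mem_univ j)]
      have hrest : ∑ l ∈ Finset.univ.erase j, |(v + (Pi.single j (-(η * v j)) : Fin p → ℝ)) l| =
          ∑ l ∈ Finset.univ.erase j, |v l| :=
        Finset.sum_congr rfl fun l hl => by
          simp [Finset.ne_of_mem_erase hl]
      rw [hrest, Pi.add_apply, Pi.single_eq_same]
      have : v j + -(η * v j) = (1 - η) * v j := by ring
      rw [this, abs_mul, abs_of_nonneg (by linarith)]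
      ring
    unfold lassoObjective at h1
    rw [hR, hs1, hs2, hl1] at h1
    have h2 : lam * η * |v j| ≤ (1 / (n : ℝ)) * (2 * (η * v j) * g + (η * v j) ^ 2 * A) := by
      linarith
    rw [one_div, ← div_eq_inv_mul, le_div_iff₀ hn'] at h2
    have hvj : 0 < |v j| := abs_pos.2 hj
    have h3 : v j * g ≤ |v j| * |g| := by
      rw [← abs_mul]
      exact le_abs_self _
    have h4 : (η * |v j|) * (n * lam) ≤ (η * |v j|) * (2 * |g| + η * (|v j| * A)) := by
      calc (η * |v j|) * (n * lam) = lam * η * |v j| * n := by ring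
        _ ≤ 2 * (η * v j) * g + (η * v j) ^ 2 * A := h2
        _ = 2 * η * (v j * g) + η ^ 2 * (v j) ^ 2 * A := by ring
        _ ≤ 2 * η * (|v j| * |g|) + η ^ 2 * (v j) ^ 2 * A := by gcongr
        _ = _ := by rw [← sq_abs (v j)]; ring
    exact le_of_mul_le_mul_left h4 (by positivity)
  refine le_of_forall_pos_le_add fun δ hδ => ?_
  have hB : 0 ≤ |v j| * A := by positivity
  have h5 := key (min 1 (δ / (|v j| * A + 1))) (lt_min one_pos (by positivity)) (min_le_left _ _)
  refine h5.trans (add_le_add_right ?_ _)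
  calc min 1 (δ / (|v j| * A + 1)) * (|v j| * A) ≤ δ / (|v j| * A + 1) * (|v j| * A) := by
        gcongr; exact min_le_right _ _
    _ = δ * ((|v j| * A) / (|v j| * A + 1)) := by ring
    _ ≤ δ * 1 := by
        gcongr
        rw [div_le_one (by positivity)]
        linarith
    _ = δ := mul_one _

/-- The residual sum of squares in terms of the errors and the estimation error. -/
theorem residualSS_model {n p : ℕ} (X : Matrix (Fin n) (Fin p) ℝ) (β : Fin p → ℝ) (e : Fin n → ℝ)
    (v : Fin p → ℝ) :
    residualSS X (fun i => X.mulVec β i + e i) v = ∑ i, e i ^ 2 -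
      2 * ∑ i, e i * X.mulVec (v - β) i + ∑ i, (X.mulVec (v - β) i) ^ 2 := by
  have h := residualSS_add X (fun i => X.mulVec β i + e i) β (v - β)
  rw [add_sub_cancel] at h
  rw [h]
  simp [residualSS]

/-- Compare the criterion at `v` and at `β`. Off `S` the penalty of `v` is that of the error `v -
β`, because `β` vanishes there; on `S` the triangle inequality loses at most the penalty of the
error. -/
theorem lasso_basic_inequality {n p : ℕ} (hn : 0 < n) {X : Matrix (Fin n) (Fin p) ℝ}
    {β : Fin p → ℝ} {e : Fin n → ℝ} {lam : ℝ} {v : Fin p → ℝ} (hlam : 0 ≤ lam)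
    (h : IsLasso X (fun i => X.mulVec β i + e i) lam v) {S : Finset (Fin p)}
    (hS : ∀ j, j ∉ S → β j = 0) :
    ∑ i, (X.mulVec (v - β) i) ^ 2 ≤ 2 * ∑ i, e i * X.mulVec (v - β) i +
      n * lam * (∑ j ∈ S, |(v - β) j| - ∑ j ∈ Finset.univ \ S, |(v - β) j|) := by
  classical
  have hn' : (0 : ℝ) < n := by exact_mod_cast hn
  have h1 := h β
  unfold lassoObjective at h1
  rw [residualSS_model, residualSS_model] at h1
  have h0 : X.mulVec (β - β) = 0 := by rw [sub_self, Matrix.mulVec_zero]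
  rw [h0] at h1
  simp only [Pi.zero_apply, mul_zero, Finset.sum_const_zero, sub_zero, ne_eq, OfNat.ofNat_ne_zero,
    not_false_eq_true, zero_pow, add_zero] at h1
  have hl : ∑ j, |β j| - ∑ j, |v j| ≤
      ∑ j ∈ S, |(v - β) j| - ∑ j ∈ Finset.univ \ S, |(v - β) j| := by
    rw [← Finset.sum_sdiff (Finset.subset_univ S), ← Finset.sum_sdiff (Finset.subset_univ S)]
    have ha : ∑ j ∈ Finset.univ \ S, |β j| = 0 :=
      Finset.sum_eq_zero fun j hj => by simp [hS j (Finset.mem_sdiff.1 hj).2]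
    have hb : ∑ j ∈ Finset.univ \ S, |(v - β) j| = ∑ j ∈ Finset.univ \ S, |v j| :=
      Finset.sum_congr rfl fun j hj => by simp [hS j (Finset.mem_sdiff.1 hj).2]
    have hc : ∑ j ∈ S, |β j| - ∑ j ∈ S, |v j| ≤ ∑ j ∈ S, |(v - β) j| := by
      rw [← Finset.sum_sub_distrib]
      refine Finset.sum_le_sum fun j _ => ?_
      rw [Pi.sub_apply, abs_sub_comm]
      exact abs_sub_abs_le_abs_sub _ _
    linarith
  set R := ∑ i, (X.mulVec (v - β) i) ^ 2
  set c := ∑ i, e i * X.mulVec (v - β) i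
  set E := ∑ i, e i ^ 2
  have h2 : (1 / (n : ℝ)) * (R - 2 * c) ≤ lam * (∑ j, |β j| - ∑ j, |v j|) := by
    linarith
  rw [one_div, ← div_eq_inv_mul, div_le_iff₀ hn'] at h2
  have h3 := mul_le_mul_of_nonneg_left hl (mul_nonneg hlam hn'.le)
  linarith

theorem sq_sum_abs_le {p : ℕ} (S : Finset (Fin p)) (h : Fin p → ℝ) :
    (∑ j ∈ S, |h j|) ^ 2 ≤ S.card * ∑ j ∈ S, h j ^ 2 := by
  have h1 := sq_sum_le_card_mul_sum_sq (s := S) (f := fun j => |h j|)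
  simpa only [sq_abs] using h1

/-- On the event that the noise is dominated by the penalty, the LASSO is sparse and its residual
sum of squares is close to that of the errors. -/
theorem lasso_oracle {n p k : ℕ} (hn : 0 < n) {X : Matrix (Fin n) (Fin p) ℝ}
    {β : Fin p → ℝ} {e : Fin n → ℝ} {lam κ₁ κ₂ : ℝ} {v : Fin p → ℝ} (hlam : 0 < lam)
    (h : IsLasso X (fun i => X.mulVec β i + e i) lam v)
    (hκ₁ : 0 < κ₁) (hκ₂ : 0 ≤ κ₂) (hk : 0 < k) (hkn : k < n)
    (hlow : numNonzero β ≠ 0 → SparseLower X κ₁ (numNonzero β + k))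
    (hup : SparseUpper X κ₂ (numNonzero β + min n p : ℕ))
    (hsk : 144 * numNonzero β * κ₂ ≤ k * κ₁)
    (hnoise : ∀ j, 4 * |∑ i, X i j * e i| ≤ n * lam) :
    (numNonzero v : ℝ) * κ₁ ≤ 144 * κ₂ * numNonzero β ∧ numNonzero v ≤ k ∧
    κ₁ * |residualSS X (fun i => X.mulVec β i + e i) v - ∑ i, e i ^ 2| ≤
      21 * (n * lam ^ 2 * numNonzero β) := by
  classical
  have hn' : (0 : ℝ) < n := by exact_mod_cast hn
  set S : Finset (Fin p) := Finset.univ.filter fun j => β j ≠ 0 with hSdef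
  have hScard : numNonzero β = S.card := rfl
  rw [hScard] at hlow hup hsk ⊢
  have hS : ∀ j, j ∉ S → β j = 0 := fun j hj => by simpa [hSdef] using hj
  set d := v - β with hd
  set Q := ∑ i, (X.mulVec d i) ^ 2 with hQ
  have hQ0 : 0 ≤ Q := Finset.sum_nonneg fun _ _ => sq_nonneg _
  set a := ∑ j ∈ S, |d j| with ha
  set b := ∑ j ∈ Finset.univ \ S, |d j| with hb
  have ha0 : 0 ≤ a := Finset.sum_nonneg fun _ _ => abs_nonneg _
  have hb0 : 0 ≤ b := Finset.sum_nonneg fun _ _ => abs_nonneg _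
  set H := ∑ j ∈ S, d j ^ 2 with hH
  have hH0 : 0 ≤ H := Finset.sum_nonneg fun _ _ => sq_nonneg _
  -- Index sets have at most `p` elements anyway, so the level `min n p` in `hup` covers every set
  -- of size up to `n`.
  have hdual : ∀ M : Finset (Fin p), M.card ≤ n → ∀ u : Fin n → ℝ,
      ∑ j ∈ M, (∑ i, X i j * u i) ^ 2 ≤ n * κ₂ * ∑ i, u i ^ 2 := by
    intro M hM u
    refine SparseUpper.sum_sq_le hκ₂ hup M ?_ u
    have h1 : M.card ≤ p := by simpa using Finset.card_le_univ M
    exact_mod_cast (le_min hM h1).trans (Nat.le_add_left _ _)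
  have hcross : 4 * |∑ i, e i * X.mulVec d i| ≤ n * lam * (a + b) := by
    rw [sum_mul_mulVec, ha, hb, add_comm, Finset.sum_sdiff (Finset.subset_univ S), Finset.mul_sum]
    calc 4 * |∑ j, d j * ∑ i, X i j * e i| ≤ 4 * ∑ j, |d j * ∑ i, X i j * e i| := by
          gcongr; exact Finset.abs_sum_le_sum_abs _ _
      _ = ∑ j, |d j| * (4 * |∑ i, X i j * e i|) := by
          rw [Finset.mul_sum]
          exact Finset.sum_congr rfl fun j _ => by rw [abs_mul]; ring
      _ ≤ ∑ j, |d j| * (n * lam) := by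
          exact Finset.sum_le_sum fun j _ => mul_le_mul_of_nonneg_left (hnoise j) (abs_nonneg _)
      _ = _ := Finset.sum_congr rfl fun j _ => by ring
  have hbasic := lasso_basic_inequality hn hlam.le h hS
  have hc1 := le_abs_self (∑ i, e i * X.mulVec d i)
  have hnl : 0 < n * lam := by positivity
  -- Domination of the noise costs half of the penalty: `2 ⟨e, X d⟩ ≤ n λ (a + b) / 2`. What remains
  -- yields both the cone condition and the prediction bound.
  have hQ1 : Q + n * lam * b / 2 ≤ 3 / 2 * (n * lam * a) := by
    have : n * lam * (a - b) = n * lam * a - n * lam * b := by ring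
    have : n * lam * (a + b) = n * lam * a + n * lam * b := by ring
    linarith
  have hcone : b ≤ 3 * a := by
    have : n * lam * b ≤ n * lam * (3 * a) := by linarith
    exact le_of_mul_le_mul_left this hnl
  have hRE := restricted_eigenvalue hκ₂ hk S hlow
    (fun M hM => hdual M (hM.trans hkn.le)) hsk d hcone
  have haH : a ^ 2 ≤ S.card * H := sq_sum_abs_le S d
  have hs0 : (0 : ℝ) ≤ S.card := Nat.cast_nonneg _
  have hnκ : 0 < n * κ₁ := by positivity
  -- the `ℓ¹` error
  have ha2 : n * κ₁ * a ^ 2 ≤ 4 * S.card * Q := by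
    calc n * κ₁ * a ^ 2 ≤ n * κ₁ * (S.card * H) := by gcongr
      _ = S.card * (n * κ₁ * H) := by ring
      _ ≤ S.card * (4 * Q) := by gcongr
      _ = _ := by ring
  have hQa : Q ≤ 3 / 2 * (n * lam * a) := by
    have : 0 ≤ n * lam * b / 2 := by positivity
    linarith
  have ha3 : κ₁ * a ≤ 6 * lam * S.card := by
    rcases ha0.eq_or_lt with hz | hz
    · rw [← hz, mul_zero]
      exact mul_nonneg (by linarith) hs0
    · have : n * a * (κ₁ * a) ≤ n * a * (6 * lam * S.card) := by
        calc n * a * (κ₁ * a) = n * κ₁ * a ^ 2 := by ring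
          _ ≤ 4 * S.card * Q := ha2
          _ ≤ 4 * S.card * (3 / 2 * (n * lam * a)) := by gcongr
          _ = _ := by ring
      exact le_of_mul_le_mul_left this (by positivity)
  have hQ3 : κ₁ * Q ≤ 9 * (n * lam ^ 2 * S.card) := by
    calc κ₁ * Q ≤ κ₁ * (3 / 2 * (n * lam * a)) := by gcongr
      _ = 3 / 2 * n * lam * (κ₁ * a) := by ring
      _ ≤ 3 / 2 * n * lam * (6 * lam * S.card) := by gcongr
      _ = _ := by ring
  -- sparsity of the estimate
  have hsupp : ∀ M : Finset (Fin p), M.card ≤ n → (∀ j ∈ M, v j ≠ 0) →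
      (M.card : ℝ) * κ₁ ≤ 144 * κ₂ * S.card := by
    intro M hM hMv
    -- On an active coordinate the residual has correlation at least `n λ / 2`, of which the noise
    -- supplies at most `n λ / 4`; the rest comes from `X d`.
    have h1 : ∀ j ∈ M, (n * lam / 4) ^ 2 ≤ (∑ i, X i j * X.mulVec d i) ^ 2 := by
      intro j hj
      have h2 := h.le_abs_corr hn (hMv j hj)
      have h3 : ∑ i, X i j * (X.mulVec β i + e i - X.mulVec v i) =
          ∑ i, X i j * e i - ∑ i, X i j * X.mulVec d i := by
        rw [← Finset.sum_sub_distrib]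
        refine Finset.sum_congr rfl fun i _ => ?_
        rw [hd, Matrix.mulVec_sub, Pi.sub_apply]
        ring
      rw [h3] at h2
      have h4 := abs_sub (∑ i, X i j * e i) (∑ i, X i j * X.mulVec d i)
      have h5 := hnoise j
      rw [← sq_abs (∑ i, X i j * X.mulVec d i)]
      exact pow_le_pow_left₀ (by positivity) (by linarith) 2
    have h6 := Finset.sum_le_sum h1
    rw [Finset.sum_const, nsmul_eq_mul] at h6
    have h7 := h6.trans (hdual M hM (X.mulVec d))
    have h8 : (n ^ 2 * lam ^ 2 / 16) * (M.card * κ₁) ≤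
        (n ^ 2 * lam ^ 2 / 16) * (144 * κ₂ * S.card) := by
      calc (n ^ 2 * lam ^ 2 / 16) * (M.card * κ₁) = κ₁ * (M.card * (n * lam / 4) ^ 2) := by ring
        _ ≤ κ₁ * (n * κ₂ * Q) := by gcongr
        _ = n * κ₂ * (κ₁ * Q) := by ring
        _ ≤ n * κ₂ * (9 * (n * lam ^ 2 * S.card)) := by gcongr
        _ = _ := by ring
    exact le_of_mul_le_mul_left h8 (by positivity)
  have hlt : ∀ M : Finset (Fin p), M.card ≤ n → (∀ j ∈ M, v j ≠ 0) → M.card ≤ k := by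
    intro M hM hMv
    have h1 := hsupp M hM hMv
    have h2 : (M.card : ℝ) * κ₁ ≤ k * κ₁ := by linarith
    exact_mod_cast le_of_mul_le_mul_right h2 hκ₁
  -- The count holds only for sets of size at most `n`, and an arbitrary minimizer might have a
  -- larger support. An `n`-element part of such a support would have at most `k < n` elements.
  have hvn : (Finset.univ.filter fun j => v j ≠ 0).card ≤ n := by
    by_contra hc
    push Not at hc
    obtain ⟨M, hM, hMn⟩ := Finset.exists_subset_card_eq hc.le
    have := hlt M hMn.le fun j hj => (Finset.mem_filter.1 (hM hj)).2
    omega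
  refine ⟨hsupp _ hvn fun j hj => (Finset.mem_filter.1 hj).2,
    hlt _ hvn fun j hj => (Finset.mem_filter.1 hj).2, ?_⟩
  rw [residualSS_model]
  have h1 : |∑ i, e i ^ 2 - 2 * ∑ i, e i * X.mulVec d i + Q - ∑ i, e i ^ 2| ≤
      2 * |∑ i, e i * X.mulVec d i| + Q := by
    rw [abs_le]
    have := neg_abs_le (∑ i, e i * X.mulVec d i)
    constructor <;> linarith
  -- With `a` of order `6 λ s / κ₁` the cross term contributes 12, and the quadratic term 9:
  -- together 21.
  have h2 : 2 * |∑ i, e i * X.mulVec d i| ≤ 2 * (n * lam * a) := by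
    have : n * lam * (a + b) ≤ n * lam * (4 * a) := by gcongr; linarith
    linarith
  calc κ₁ * |∑ i, e i ^ 2 - 2 * ∑ i, e i * X.mulVec d i + Q - ∑ i, e i ^ 2|
      ≤ κ₁ * (2 * (n * lam * a) + Q) := by gcongr; linarith
    _ = 2 * n * lam * (κ₁ * a) + κ₁ * Q := by ring
    _ ≤ 2 * n * lam * (6 * lam * S.card) + 9 * (n * lam ^ 2 * S.card) := by gcongr
    _ = _ := by ring

/-- Without a domination of the noise, the residual sum of squares is controlled by the part of the
errors in the column space of the design. -/
theorem lasso_low_dim {n p : ℕ} (hn : 0 < n) {X : Matrix (Fin n) (Fin p) ℝ}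
    {β : Fin p → ℝ} {e : Fin n → ℝ} {lam κ₁ q : ℝ} {v : Fin p → ℝ} (hlam : 0 ≤ lam)
    (h : IsLasso X (fun i => X.mulVec β i + e i) lam v) (hκ₁ : 0 < κ₁)
    (hlow : numNonzero β ≠ 0 → SparseLower X κ₁ p)
    (hq : ∀ w, 2 * ∑ i, e i * X.mulVec w i - (∑ i, (X.mulVec w i) ^ 2) / 2 ≤ q) :
    |residualSS X (fun i => X.mulVec β i + e i) v - ∑ i, e i ^ 2| ≤
      7 * (q + n * lam ^ 2 * numNonzero β / κ₁) := by
  classical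
  have hn' : (0 : ℝ) < n := by exact_mod_cast hn
  set S : Finset (Fin p) := Finset.univ.filter fun j => β j ≠ 0 with hSdef
  have hScard : numNonzero β = S.card := rfl
  rw [hScard] at hlow ⊢
  have hS : ∀ j, j ∉ S → β j = 0 := fun j hj => by simpa [hSdef] using hj
  set d := v - β with hd
  set Q := ∑ i, (X.mulVec d i) ^ 2 with hQ
  have hQ0 : 0 ≤ Q := Finset.sum_nonneg fun _ _ => sq_nonneg _
  set a := ∑ j ∈ S, |d j| with ha
  set b := ∑ j ∈ Finset.univ \ S, |d j| with hb
  have ha0 : 0 ≤ a := Finset.sum_nonneg fun _ _ => abs_nonneg _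
  have hb0 : 0 ≤ b := Finset.sum_nonneg fun _ _ => abs_nonneg _
  have hbasic := lasso_basic_inequality hn hlam h hS
  have hq1 := hq d
  have hq2 := hq (-d)
  -- Using `hq` at `d` and at `-d` bounds the cross term from both sides: `2 |⟨e, X d⟩| ≤ q + Q /
  -- 2`.
  simp only [Matrix.mulVec_neg, Pi.neg_apply, neg_sq, mul_neg, Finset.sum_neg_distrib] at hq2
  -- The inequality between means, with weights leaving only `Q / 4`: the basic inequality then
  -- retains a quarter of `Q` on its left, whence the factor 4 in `hQ1` and finally `1 + 4 * 3 / 2 =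
  -- 7`.
  have hpen : n * lam * a ≤ Q / 4 + n * lam ^ 2 * S.card / κ₁ := by
    by_cases hc : S.card = 0
    · have : a = 0 := by rw [ha, Finset.card_eq_zero.1 hc, Finset.sum_empty]
      rw [this, hc]
      simp only [mul_zero, Nat.cast_zero, zero_div, add_zero]
      positivity
    · have hnn : (numNonzero d : ℝ) ≤ p := by
        have : numNonzero d ≤ p := by
          exact (Finset.card_le_univ (Finset.univ.filter fun j => d j ≠ 0)).trans (by simp)
        exact_mod_cast this
      have h1 := hlow hc d hnn
      have h2 : a ^ 2 ≤ S.card * ∑ j, d j ^ 2 := by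
        refine (sq_sum_abs_le S d).trans (mul_le_mul_of_nonneg_left ?_ (Nat.cast_nonneg _))
        exact Finset.sum_le_sum_of_subset_of_nonneg (Finset.subset_univ _)
          fun _ _ _ => sq_nonneg _
      have hs : (0 : ℝ) < S.card := by exact_mod_cast Nat.pos_of_ne_zero hc
      have h3 : n * κ₁ * a ^ 2 ≤ S.card * Q := by
        calc n * κ₁ * a ^ 2 ≤ n * κ₁ * (S.card * ∑ j, d j ^ 2) := by gcongr
          _ = S.card * (n * κ₁ * ∑ j, d j ^ 2) := by ring
          _ ≤ _ := by gcongr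
      have h4 : n * κ₁ * a ^ 2 / (4 * S.card) ≤ Q / 4 := by
        rw [div_le_div_iff₀ (by positivity) (by norm_num)]
        linarith
      have h5 : n * lam * a ≤ n * κ₁ * a ^ 2 / (4 * S.card) + n * lam ^ 2 * S.card / κ₁ := by
        have : n * κ₁ * a ^ 2 / (4 * S.card) + n * lam ^ 2 * S.card / κ₁ - n * lam * a =
            n * (κ₁ * a - 2 * lam * S.card) ^ 2 / (4 * S.card * κ₁) := by
          field_simp
          ring
        have h6 : 0 ≤ n * (κ₁ * a - 2 * lam * S.card) ^ 2 / (4 * S.card * κ₁) := by positivity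
        linarith
      linarith
  have hQ1 : Q ≤ 4 * (q + n * lam ^ 2 * S.card / κ₁) := by
    have h1 : n * lam * (a - b) ≤ n * lam * a := by
      have : 0 ≤ n * lam * b := by positivity
      linarith
    linarith
  have hq0 : 0 ≤ q := by simpa using hq 0
  have hR0 : 0 ≤ n * lam ^ 2 * S.card / κ₁ := by positivity
  rw [residualSS_model, abs_le]
  constructor <;> linarith

/-- The plug-in variance in terms of the mean of the squared errors. -/
theorem plugInVariance_sub_abs_le {n p : ℕ} (hn : 0 < n) (X : Matrix (Fin n) (Fin p) ℝ)
    (y e : Fin n → ℝ) (v : Fin p → ℝ) (t : ℝ) (ht : 0 ≤ t) {B : ℝ}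
    (hR : |residualSS X y v - ∑ i, e i ^ 2| ≤ B) (hv : 2 * numNonzero v ≤ n) :
    |plugInVariance X y v - t - ((∑ i, e i ^ 2) / n - t)| ≤
      2 * numNonzero v / n * |(∑ i, e i ^ 2) / n - t| + 2 * (B + numNonzero v * t) / n := by
  have hn' : (0 : ℝ) < n := by exact_mod_cast hn
  have hv' : 2 * (numNonzero v : ℝ) ≤ n := by exact_mod_cast hv
  set s : ℝ := (numNonzero v : ℝ) with hs
  have hs0 : 0 ≤ s := Nat.cast_nonneg _
  set R := residualSS X y v
  set E := ∑ i, e i ^ 2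
  have hpos : 0 < n - s := by linarith
  have hinv : 1 / (n - s) ≤ 2 / n := by
    rw [div_le_div_iff₀ hpos hn']
    linarith
  unfold plugInVariance
  have h1 : 1 / ((n : ℝ) - s) * R - t - (E / n - t) =
      1 / (n - s) * ((R - E) + s * (E / n - t) + s * t) := by
    field_simp
    ring
  rw [h1, abs_mul, abs_of_nonneg (by positivity)]
  have h2 : |R - E + s * (E / n - t) + s * t| ≤ B + s * |E / n - t| + s * t := by
    refine (abs_add_le _ _).trans (add_le_add ((abs_add_le _ _).trans (add_le_add hR ?_)) ?_)
    · rw [abs_mul, abs_of_nonneg hs0]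
    · rw [abs_of_nonneg (by positivity)]
  calc _ ≤ 2 / n * (B + s * |E / n - t| + s * t) :=
        mul_le_mul hinv h2 (abs_nonneg _) (by positivity)
    _ = _ := by ring

/-! ### Projections and weighted sums of i.i.d. errors -/

/-- An orthonormal system of the column space controls the linear functional `e` on it. -/
theorem exists_orthonormal_columns {n p : ℕ} (X : Matrix (Fin n) (Fin p) ℝ) :
    ∃ (m : ℕ) (B : Fin m → Fin n → ℝ), m ≤ p ∧ (∀ k, ∑ i, B k i ^ 2 = 1) ∧
      ∀ (e : Fin n → ℝ) (w : Fin p → ℝ),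
        2 * ∑ i, e i * X.mulVec w i - (∑ i, (X.mulVec w i) ^ 2) / 2 ≤
          2 * ∑ k, (∑ i, B k i * e i) ^ 2 := by
  let f : (Fin p → ℝ) →ₗ[ℝ] EuclideanSpace ℝ (Fin n) :=
    (WithLp.linearEquiv 2 ℝ (Fin n → ℝ)).symm.toLinearMap ∘ₗ X.mulVecLin
  let b := stdOrthonormalBasis ℝ (LinearMap.range f)
  refine ⟨Module.finrank ℝ (LinearMap.range f), fun k i => (b k : EuclideanSpace ℝ (Fin n)) i,
    ?_, fun k => ?_, fun e w => ?_⟩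
  · simpa using LinearMap.finrank_range_le f
  · have h1 : ‖(b k : EuclideanSpace ℝ (Fin n))‖ = 1 := by
      rw [← Submodule.coe_norm]
      exact b.orthonormal.1 k
    rw [← EuclideanSpace.real_norm_sq_eq, h1, one_pow]
  · let E : EuclideanSpace ℝ (Fin n) := WithLp.toLp 2 e
    let z : LinearMap.range f := ⟨f w, LinearMap.mem_range_self f w⟩
    have hz : ∀ i, (z : EuclideanSpace ℝ (Fin n)) i = X.mulVec w i := fun i => rfl
    have h1 : ∑ i, e i * X.mulVec w i = ∑ k, inner ℝ (b k) z *
        ∑ i, (b k : EuclideanSpace ℝ (Fin n)) i * e i := by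
      have h2 : ∑ i, e i * X.mulVec w i = inner ℝ E (z : EuclideanSpace ℝ (Fin n)) := by
        simp only [PiLp.inner_apply, hz]
        simp [E, mul_comm]
      have h3 : (z : EuclideanSpace ℝ (Fin n)) =
          ∑ k, inner ℝ (b k) z • (b k : EuclideanSpace ℝ (Fin n)) := by
        conv_lhs => rw [← b.sum_repr' z]
        simp
      rw [h2, h3, inner_sum]
      refine Finset.sum_congr rfl fun k _ => ?_
      rw [inner_smul_right, PiLp.inner_apply]
      simp [E]
    have h4 : ∑ i, (X.mulVec w i) ^ 2 = ∑ k, inner ℝ (b k) z ^ 2 := by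
      rw [b.sum_sq_inner_right, Submodule.coe_norm, EuclideanSpace.real_norm_sq_eq]
      exact Finset.sum_congr rfl fun i _ => by rw [hz]
    rw [h1, h4, Finset.mul_sum, Finset.mul_sum, Finset.sum_div, ← Finset.sum_sub_distrib]
    refine Finset.sum_le_sum fun k _ => ?_
    -- Complete the square in each coordinate: `2 z c - z² / 2 ≤ 2 c²`.
    nlinarith [sq_nonneg (inner ℝ (b k) z - 2 * ∑ i, (b k : EuclideanSpace ℝ (Fin n)) i * e i)]

theorem integrable_exp_abs_div {ν : Measure ℝ} {a b : ℝ}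
    (hν_exp : ∫⁻ x, ENNReal.ofReal (Real.exp (|x| / a)) ∂ν ≤ ENNReal.ofReal b) :
    Integrable (fun x => Real.exp (|x| / a)) ν := by
  refine ⟨by fun_prop, ?_⟩
  rw [hasFiniteIntegral_iff_ofReal (ae_of_all _ fun x => (Real.exp_pos _).le)]
  exact hν_exp.trans_lt ENNReal.ofReal_lt_top

theorem integral_exp_abs_div_le {ν : Measure ℝ} {a b : ℝ} (hb : 0 ≤ b)
    (hν_exp : ∫⁻ x, ENNReal.ofReal (Real.exp (|x| / a)) ∂ν ≤ ENNReal.ofReal b) :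
    ∫ x, Real.exp (|x| / a) ∂ν ≤ b := by
  rw [integral_eq_lintegral_of_nonneg_ae (ae_of_all _ fun x => (Real.exp_pos _).le) (by fun_prop)]
  exact ENNReal.toReal_le_of_le_ofReal hb hν_exp

theorem integrable_pow_of_exp {ν : Measure ℝ} {a b : ℝ} (ha : 0 < a)
    (hν_exp : ∫⁻ x, ENNReal.ofReal (Real.exp (|x| / a)) ∂ν ≤ ENNReal.ofReal b) (k : ℕ) :
    Integrable (fun x => x ^ k) ν := by
  refine ((integrable_exp_abs_div hν_exp).const_mul (a ^ k * k.factorial)).mono' (by fun_prop)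
    (ae_of_all _ fun x => ?_)
  have h := Real.pow_div_factorial_le_exp (x := |x| / a) (by positivity) k
  rw [div_pow, div_div, div_le_iff₀ (by positivity)] at h
  rw [Real.norm_eq_abs, abs_pow]
  linarith

theorem integrable_exp_mul {ν : Measure ℝ} {a b u : ℝ} (ha : 0 < a)
    (hν_exp : ∫⁻ x, ENNReal.ofReal (Real.exp (|x| / a)) ∂ν ≤ ENNReal.ofReal b)
    (hu : 2 * a * |u| ≤ 1) : Integrable (fun x => Real.exp (u * x)) ν := by
  refine (integrable_exp_abs_div hν_exp).mono' (by fun_prop) (ae_of_all _ fun x => ?_)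
  rw [Real.norm_eq_abs, Real.abs_exp, Real.exp_le_exp, le_div_iff₀ ha]
  calc u * x * a ≤ |u * x * a| := le_abs_self _
    _ = (a * |u|) * |x| := by rw [abs_mul, abs_mul, abs_of_pos ha]; ring
    _ ≤ 1 * |x| := by
        refine mul_le_mul_of_nonneg_right ?_ (abs_nonneg _)
        nlinarith [abs_nonneg u]
    _ = |x| := one_mul _

section Moments

variable {n : ℕ} {ν : Measure ℝ} [IsProbabilityMeasure ν]

theorem memLp_weighted_sum_pi {f : ℝ → ℝ} (hf : MemLp f 2 ν) (w : Fin n → ℝ) :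
    MemLp (fun e : Fin n → ℝ => ∑ i, w i * f (e i)) 2 (Measure.pi fun _ => ν) :=
  memLp_finsetSum _ fun i _ =>
    (hf.comp_measurePreserving (measurePreserving_eval (fun _ : Fin n => ν) i)).const_mul (w i)

theorem integral_weighted_sum_pi {f : ℝ → ℝ} (hf : MemLp f 2 ν) (h0 : ∫ x, f x ∂ν = 0)
    (w : Fin n → ℝ) :
    ∫ e : Fin n → ℝ, ∑ i, w i * f (e i) ∂(Measure.pi fun _ => ν) = 0 := by
  rw [integral_finsetSum]
  · refine Finset.sum_eq_zero fun i _ => ?_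
    rw [integral_const_mul, integral_comp_eval (μ := fun _ : Fin n => ν) hf.1, h0, mul_zero]
  · intro i _
    exact ((hf.comp_measurePreserving (measurePreserving_eval (fun _ : Fin n => ν) i)).integrable
      one_le_two).const_mul (w i)

theorem variance_weighted_sum_pi {f : ℝ → ℝ} (hf : MemLp f 2 ν) (h0 : ∫ x, f x ∂ν = 0)
    (w : Fin n → ℝ) :
    Var[fun e : Fin n → ℝ => ∑ i, w i * f (e i); Measure.pi fun _ => ν] =
      (∫ x, f x ^ 2 ∂ν) * ∑ i, w i ^ 2 := by
  have h := variance_sum_pi (μ := fun _ : Fin n => ν) (X := fun i x => w i * f x)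
    fun i => hf.const_mul (w i)
  have he : (∑ i, fun e : Fin n → ℝ => w i * f (e i)) = fun e => ∑ i, w i * f (e i) := by
    ext e; simp
  rw [he] at h
  rw [h, Finset.mul_sum]
  refine Finset.sum_congr rfl fun i _ => ?_
  rw [variance_const_mul, variance_of_integral_eq_zero hf.1.aemeasurable h0, mul_comm]

theorem measure_pi_weighted_sum_ge {f : ℝ → ℝ} (hf : MemLp f 2 ν) (h0 : ∫ x, f x ∂ν = 0)
    (w : Fin n → ℝ) {t : ℝ} (ht : 0 < t) :
    (Measure.pi fun _ : Fin n => ν) {e | t ≤ |∑ i, w i * f (e i)|} ≤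
      ENNReal.ofReal ((∫ x, f x ^ 2 ∂ν) * (∑ i, w i ^ 2) / t ^ 2) := by
  have h := meas_ge_le_variance_div_sq (memLp_weighted_sum_pi hf w) ht
  rw [integral_weighted_sum_pi hf h0, variance_weighted_sum_pi hf h0] at h
  simpa using h

/-- The part of the errors in the column space of the design has mean square at most `σ² p`. -/
theorem measure_pi_projection_gt {p : ℕ} (hf : MemLp (fun x : ℝ => x) 2 ν) (h0 : ∫ x, x ∂ν = 0)
    (X : Matrix (Fin n) (Fin p) ℝ) {q : ℝ} (hq : 0 < q) :
    (Measure.pi fun _ : Fin n => ν)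
        {e | ∃ w, q < 2 * ∑ i, e i * X.mulVec w i - (∑ i, (X.mulVec w i) ^ 2) / 2} ≤
      ENNReal.ofReal (2 * (∫ x, x ^ 2 ∂ν) * p / q) := by
  obtain ⟨m, B, hmp, hB1, hB⟩ := exists_orthonormal_columns X
  set P := Measure.pi fun _ : Fin n => ν with hP
  have hV : 0 ≤ ∫ x, x ^ 2 ∂ν := integral_nonneg fun x => sq_nonneg _
  have hint : ∀ k, Integrable (fun e : Fin n → ℝ => (∑ i, B k i * e i) ^ 2) P := fun k =>
    (memLp_weighted_sum_pi hf (B k)).integrable_sq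
  have hI : ∫ e, 2 * ∑ k, (∑ i, B k i * e i) ^ 2 ∂P = 2 * (m * ∫ x, x ^ 2 ∂ν) := by
    rw [integral_const_mul, integral_finsetSum _ fun k _ => hint k]
    congr 1
    rw [Finset.sum_congr rfl (g := fun _ => ∫ x, x ^ 2 ∂ν)]
    · simp
    · intro k _
      have h1 := variance_weighted_sum_pi hf h0 (B k)
      rw [variance_of_integral_eq_zero (memLp_weighted_sum_pi hf (B k)).1.aemeasurable
        (integral_weighted_sum_pi hf h0 (B k)), hB1, mul_one] at h1
      exact h1
  have hM := mul_meas_ge_le_integral_of_nonneg (μ := P)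
    (f := fun e => 2 * ∑ k, (∑ i, B k i * e i) ^ 2)
    (ae_of_all _ fun e => mul_nonneg zero_le_two (Finset.sum_nonneg fun _ _ => sq_nonneg _))
    ((integrable_finsetSum _ fun k _ => hint k).const_mul 2) q
  rw [hI] at hM
  have hsub : P {e | ∃ w, q < 2 * ∑ i, e i * X.mulVec w i - (∑ i, (X.mulVec w i) ^ 2) / 2} ≤
      P {e | q ≤ 2 * ∑ k, (∑ i, B k i * e i) ^ 2} :=
    measure_mono fun e ⟨w, hw⟩ => hw.le.trans (hB e w)
  refine hsub.trans ?_
  rw [← ofReal_measureReal]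
  refine ENNReal.ofReal_le_ofReal ?_
  rw [le_div_iff₀ hq, mul_comm]
  refine hM.trans ?_
  have : (m : ℝ) ≤ p := by exact_mod_cast hmp
  nlinarith

theorem memLp_sq_sub_of_exp {a b : ℝ} (ha : 0 < a)
    (hν_exp : ∫⁻ x, ENNReal.ofReal (Real.exp (|x| / a)) ∂ν ≤ ENNReal.ofReal b) (t : ℝ) :
    MemLp (fun x => x ^ 2 - t) 2 ν := by
  rw [memLp_two_iff_integrable_sq (by fun_prop)]
  have h : (fun x : ℝ => (x ^ 2 - t) ^ 2) = fun x => x ^ 4 - 2 * t * x ^ 2 + t ^ 2 := by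
    ext x; ring
  rw [h]
  exact ((integrable_pow_of_exp ha hν_exp 4).sub
    ((integrable_pow_of_exp ha hν_exp 2).const_mul _)).add (integrable_const _)

/-- A centred law with an exponential moment has a sub-Gaussian moment generating function near
the origin. -/
theorem integral_exp_mul_le {a b u : ℝ} (ha : 0 < a) (hb : 0 ≤ b) (hν_mean : ∫ x, x ∂ν = 0)
    (hν_exp : ∫⁻ x, ENNReal.ofReal (Real.exp (|x| / a)) ∂ν ≤ ENNReal.ofReal b)
    (hu : 2 * a * |u| ≤ 1) : ∫ x, Real.exp (u * x) ∂ν ≤ Real.exp (8 * a ^ 2 * b * u ^ 2) := by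
  -- The Taylor remainder is at most `|u x|² exp |u x|`. Since `|u x| ≤ |x| / (2 a)`, half of the
  -- exponent `|x| / a` pays for the exponential factor and the other half for `x²`. The linear term
  -- vanishes on integration.
  have hpt : ∀ x : ℝ, Real.exp (u * x) ≤ 1 + u * x + 8 * a ^ 2 * u ^ 2 * Real.exp (|x| / a) := by
    intro x
    have h1 : Real.exp (u * x) - (1 + u * x) ≤ |u * x| ^ 2 * Real.exp |u * x| := by
      have h := Complex.norm_exp_sub_sum_le_norm_mul_exp ((u * x : ℝ) : ℂ) 2
      rw [Finset.sum_range_succ, Finset.sum_range_one] at h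
      simp only [pow_zero, Nat.factorial_zero, Nat.cast_one, div_one, pow_one,
        Nat.factorial_one] at h
      rw [← Complex.ofReal_exp, ← Complex.ofReal_one, ← Complex.ofReal_add, ← Complex.ofReal_sub,
        Complex.norm_real, Complex.norm_real, Real.norm_eq_abs, Real.norm_eq_abs] at h
      exact (le_abs_self _).trans h
    have h2 : |u * x| ≤ |x| / (2 * a) := by
      rw [le_div_iff₀ (by positivity), abs_mul]
      nlinarith [abs_nonneg x]
    have h3 := Real.pow_div_factorial_le_exp (x := |x| / (2 * a)) (by positivity) 2
    have h4 : |x| ^ 2 ≤ 8 * a ^ 2 * Real.exp (|x| / (2 * a)) := by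
      rw [div_pow, div_div, div_le_iff₀ (by positivity)] at h3
      simp only [Nat.factorial_two] at h3
      push_cast at h3
      linarith
    have h5 : Real.exp (|x| / a) = Real.exp (|x| / (2 * a)) * Real.exp (|x| / (2 * a)) := by
      rw [← Real.exp_add]
      congr 1
      field_simp
      ring
    have h6 : |u * x| ^ 2 * Real.exp |u * x| ≤
        u ^ 2 * (8 * a ^ 2 * Real.exp (|x| / (2 * a))) * Real.exp (|x| / (2 * a)) := by
      rw [abs_mul, mul_pow, sq_abs u, ← abs_mul]
      gcongr
    rw [h5]
    linarith
  have hint1 : Integrable (fun x : ℝ => x) ν := by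
    simpa using integrable_pow_of_exp ha hν_exp 1
  have hint2 := integrable_exp_abs_div hν_exp
  calc ∫ x, Real.exp (u * x) ∂ν
      ≤ ∫ x, (1 + u * x + 8 * a ^ 2 * u ^ 2 * Real.exp (|x| / a)) ∂ν := by
        refine integral_mono (integrable_exp_mul ha hν_exp hu) ?_ hpt
        exact ((integrable_const _).add (hint1.const_mul u)).add (hint2.const_mul _)
    _ = 1 + 8 * a ^ 2 * u ^ 2 * ∫ x, Real.exp (|x| / a) ∂ν := by
        have hA : Integrable (fun x : ℝ => 1 + u * x) ν :=
          (integrable_const _).add (hint1.const_mul u)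
        rw [integral_add hA (hint2.const_mul _),
          integral_add (integrable_const _) (hint1.const_mul u), integral_const_mul,
          integral_const_mul, hν_mean]
        simp
    _ ≤ 1 + 8 * a ^ 2 * u ^ 2 * b := by
        gcongr
        exact integral_exp_abs_div_le hb hν_exp
    _ = 8 * a ^ 2 * b * u ^ 2 + 1 := by ring
    _ ≤ _ := Real.add_one_le_exp _

/-- Chernoff's bound with the parameter `u` left free; it is tuned to the penalty in
`measure_noise_gt_penalty`. -/
theorem measure_pi_weighted_sum_ge_exp {a b u L : ℝ} (ha : 0 < a) (hb : 0 ≤ b)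
    (hν_mean : ∫ x, x ∂ν = 0)
    (hν_exp : ∫⁻ x, ENNReal.ofReal (Real.exp (|x| / a)) ∂ν ≤ ENNReal.ofReal b)
    (hu0 : 0 ≤ u) (hu : 2 * a * (u * L) ≤ 1) (w : Fin n → ℝ) (hw : ∀ i, |w i| ≤ L) (t : ℝ) :
    (Measure.pi fun _ : Fin n => ν) {e | t ≤ ∑ i, w i * e i} ≤
      ENNReal.ofReal (Real.exp (-(u * t) + 8 * a ^ 2 * b * (u ^ 2 * L ^ 2) * n)) := by
  set P := Measure.pi fun _ : Fin n => ν with hP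
  have hui : ∀ i, 2 * a * |u * w i| ≤ 1 := by
    intro i
    rw [abs_mul, abs_of_nonneg hu0]
    refine le_trans ?_ hu
    have := hw i
    gcongr
  have hprod : (fun e : Fin n → ℝ => Real.exp (u * ∑ i, w i * e i)) =
      fun e => ∏ i, Real.exp (u * w i * e i) := by
    ext e
    rw [Finset.mul_sum, Real.exp_sum]
    simp only [mul_assoc]
  have hint : Integrable (fun e : Fin n → ℝ => Real.exp (u * ∑ i, w i * e i)) P := by
    rw [hprod]
    exact Integrable.fintype_prod (f := fun i x => Real.exp (u * w i * x)) (μ := fun _ => ν)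
      fun i => integrable_exp_mul ha hν_exp (hui i)
  have hmgf : ∫ e, Real.exp (u * ∑ i, w i * e i) ∂P ≤
      Real.exp (8 * a ^ 2 * b * (u ^ 2 * L ^ 2) * n) := by
    rw [hprod, integral_fintype_prod_eq_prod (fun i x => Real.exp (u * w i * x)) (μ := fun _ => ν)]
    calc ∏ i, ∫ x, Real.exp (u * w i * x) ∂ν
        ≤ ∏ _i : Fin n, Real.exp (8 * a ^ 2 * b * (u ^ 2 * L ^ 2)) := by
          refine Finset.prod_le_prod (fun i _ => integral_nonneg fun x => (Real.exp_pos _).le)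
            fun i _ => (integral_exp_mul_le ha hb hν_mean hν_exp (hui i)).trans ?_
          rw [Real.exp_le_exp, mul_pow, ← sq_abs (w i)]
          have := hw i
          gcongr
      _ = _ := by
          rw [Finset.prod_const, Finset.card_univ, Fintype.card_fin, ← Real.exp_nat_mul]
          congr 1
          ring
  have h := measure_ge_le_exp_mul_mgf (μ := P) (X := fun e => ∑ i, w i * e i) t hu0 hint
  rw [← ofReal_measureReal]
  refine ENNReal.ofReal_le_ofReal (h.trans ?_)
  rw [Real.exp_add, neg_mul]
  exact mul_le_mul_of_nonneg_left hmgf (Real.exp_pos _).le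

theorem measure_pi_abs_weighted_sum_ge_exp {a b u L : ℝ} (ha : 0 < a) (hb : 0 ≤ b)
    (hν_mean : ∫ x, x ∂ν = 0)
    (hν_exp : ∫⁻ x, ENNReal.ofReal (Real.exp (|x| / a)) ∂ν ≤ ENNReal.ofReal b)
    (hu0 : 0 ≤ u) (hu : 2 * a * (u * L) ≤ 1) (w : Fin n → ℝ) (hw : ∀ i, |w i| ≤ L) (t : ℝ) :
    (Measure.pi fun _ : Fin n => ν) {e | t ≤ |∑ i, w i * e i|} ≤
      ENNReal.ofReal (2 * Real.exp (-(u * t) + 8 * a ^ 2 * b * (u ^ 2 * L ^ 2) * n)) := by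
  have h1 := measure_pi_weighted_sum_ge_exp ha hb hν_mean hν_exp hu0 hu w hw t
  have h2 := measure_pi_weighted_sum_ge_exp ha hb hν_mean hν_exp hu0 hu (fun i => -w i)
    (fun i => by rw [abs_neg]; exact hw i) t
  rw [two_mul, ENNReal.ofReal_add (Real.exp_pos _).le (Real.exp_pos _).le]
  refine (measure_mono ?_).trans ((measure_union_le _ _).trans (add_le_add h1 h2))
  intro e he
  rcases le_abs.1 (show t ≤ |∑ i, w i * e i| from he) with h | h
  · exact Or.inl h
  · right
    simpa [neg_mul, Finset.sum_neg_distrib] using h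

end Moments

/-! ### From fixed to random designs -/

/-- For independent `U` and `V`, a bound on the sections gives a bound on the probability. -/
theorem IndepFun.measure_pair_le {Ω α β : Type*} [MeasurableSpace Ω] [MeasurableSpace α]
    [MeasurableSpace β] {μ : Measure Ω} [IsProbabilityMeasure μ] {U : Ω → α} {V : Ω → β}
    (hU : Measurable U) (hV : Measurable V) (h : IndepFun U V μ) {B : Set (α × β)}
    (hB : MeasurableSet B) {D : Set α} (hD : MeasurableSet D) (hUD : ∀ᵐ ω ∂μ, U ω ∈ D) {δ : ℝ≥0∞}
    (hδ : ∀ x ∈ D, μ.map V {y | (x, y) ∈ B} ≤ δ) : μ {ω | (U ω, V ω) ∈ B} ≤ δ := by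
  have h1 := (indepFun_iff_map_prod_eq_prod_map_map hU.aemeasurable hV.aemeasurable).1 h
  have : IsProbabilityMeasure (μ.map U) := Measure.isProbabilityMeasure_map hU.aemeasurable
  have : IsProbabilityMeasure (μ.map V) := Measure.isProbabilityMeasure_map hV.aemeasurable
  calc μ {ω | (U ω, V ω) ∈ B} = μ.map (fun ω => (U ω, V ω)) B :=
        (Measure.map_apply (hU.prodMk hV) hB).symm
    _ = ∫⁻ x, μ.map V (Prod.mk x ⁻¹' B) ∂μ.map U := by rw [h1, Measure.prod_apply hB]
    _ ≤ ∫⁻ _, δ ∂μ.map U := by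
        refine lintegral_mono_ae ?_
        have : ∀ᵐ x ∂μ.map U, x ∈ D := (ae_map_iff hU.aemeasurable hD).2 hUD
        filter_upwards [this] with x hx using hδ x hx
    _ = δ := by simp

/-- Events that almost surely occur eventually have probabilities tending to one. -/
theorem tendsto_measure_compl_of_ae_eventually {Ω : Type*} [MeasurableSpace Ω] {μ : Measure Ω}
    [IsFiniteMeasure μ] {D : ℕ → Set Ω} (hD : ∀ n, MeasurableSet (D n))
    (h : ∀ᵐ ω ∂μ, ∀ᶠ n in atTop, ω ∈ D n) : Tendsto (fun n => μ (D n)ᶜ) atTop (𝓝 0) := by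
  let A : ℕ → Set Ω := fun n => ⋃ k ≥ n, (D k)ᶜ
  have hA : Antitone A := fun m n hmn =>
    Set.biUnion_subset_biUnion_left fun k (hk : k ≥ n) => hmn.trans hk
  have hAm : ∀ n, MeasurableSet (A n) := fun n =>
    MeasurableSet.iUnion fun k => MeasurableSet.iUnion fun _ => (hD k).compl
  have h0 : μ (⋂ n, A n) = 0 := by
    refine measure_mono_null ?_ (ae_iff.1 h)
    intro ω hω
    simp only [Set.mem_ofPred_eq, eventually_atTop, not_exists, not_forall]
    intro n
    have := Set.mem_iInter.1 hω n
    simpa [A] using this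
  have h1 := tendsto_measure_iInter_atTop (μ := μ) (fun n => (hAm n).nullMeasurableSet) hA
    ⟨0, measure_ne_top _ _⟩
  rw [h0] at h1
  refine tendsto_of_tendsto_of_tendsto_of_le_of_le tendsto_const_nhds h1 (fun _ => zero_le) ?_
  intro n
  exact measure_mono (Set.subset_biUnion_of_mem (u := fun k => (D k)ᶜ) (le_refl n))

/-- An intersection over `v` of closed conditions on the design; this is what makes the sparse
eigenvalue events measurable. -/
theorem isClosed_sparseLower {n p : ℕ} (κ m : ℝ) :
    IsClosed {x : Fin n → Fin p → ℝ | SparseLower (Matrix.of x) κ m} := by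
  simp only [SparseLower, Set.ofPred_forall]
  refine isClosed_iInter fun v => isClosed_iInter fun _ => isClosed_le continuous_const ?_
  simp only [Matrix.mulVec, dotProduct, Matrix.of_apply]
  fun_prop

theorem isClosed_sparseUpper {n p : ℕ} (κ m : ℝ) :
    IsClosed {x : Fin n → Fin p → ℝ | SparseUpper (Matrix.of x) κ m} := by
  simp only [SparseUpper, Set.ofPred_forall]
  refine isClosed_iInter fun v => isClosed_iInter fun _ => isClosed_le ?_ continuous_const
  simp only [Matrix.mulVec, dotProduct, Matrix.of_apply]
  fun_prop

/-- The sparse eigenvalue bounds of the limit hold with probability tending to one, up to a factor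
of two. -/
theorem tendsto_measure_sparse_compl {Ω : Type*} [MeasurableSpace Ω] {μ : Measure Ω}
    [IsProbabilityMeasure μ] {p : ℕ → ℕ} {X : ∀ n, Ω → Matrix (Fin n) (Fin (p n)) ℝ}
    (hX : ∀ n i j, Measurable fun ω => X n ω i j) {kmin kmax : ℝ} (hkmin : 0 < kmin)
    (hkmax : 0 < kmax) {ℓ m : ℕ → ℝ}
    (hlow : ∀ᵐ ω ∂μ, ENNReal.ofReal kmin ≤ liminf (fun n => phiMin (X n ω) (ℓ n)) atTop)
    (hup : ∀ᵐ ω ∂μ, limsup (fun n => phiMax (X n ω) (m n)) atTop ≤ ENNReal.ofReal kmax) :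
    Tendsto (fun n => μ {ω | SparseLower (X n ω) (kmin / 2) (ℓ n) ∧
      SparseUpper (X n ω) (2 * kmax) (m n)}ᶜ) atTop (𝓝 0) := by
  have hXm : ∀ n, Measurable fun ω i j => X n ω i j := fun n =>
    measurable_pi_lambda _ fun i => measurable_pi_lambda _ fun j => hX n i j
  refine tendsto_measure_compl_of_ae_eventually (fun n => ?_) ?_
  · exact (hXm n (isClosed_sparseLower _ _).measurableSet).inter
      (hXm n (isClosed_sparseUpper _ _).measurableSet)
  · filter_upwards [hlow, hup] with ω h1 h2
    have h3 : ENNReal.ofReal (kmin / 2) < liminf (fun n => phiMin (X n ω) (ℓ n)) atTop :=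
      lt_of_lt_of_le ((ENNReal.ofReal_lt_ofReal_iff hkmin).2 (by linarith)) h1
    have h4 : limsup (fun n => phiMax (X n ω) (m n)) atTop < ENNReal.ofReal (2 * kmax) :=
      lt_of_le_of_lt h2 ((ENNReal.ofReal_lt_ofReal_iff (by linarith)).2 (by linarith))
    filter_upwards [eventually_lt_of_lt_liminf h3, eventually_lt_of_limsup_lt h4,
      eventually_gt_atTop 0] with n h5 h6 hn
    exact ⟨sparseLower_of_le_phiMin hn (by linarith) h5.le,
      sparseUpper_of_phiMax_le hn (by linarith) h6.le⟩

section FixedSampleSize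

variable {Ω : Type*} [MeasurableSpace Ω] {μ : Measure Ω} [IsProbabilityMeasure μ] {n : ℕ}
  {ν : Measure ℝ} {ε : Fin n → Ω → ℝ}

theorem map_errors_eq_pi (hε : ∀ i, Measurable (ε i)) (hlaw : ∀ i, μ.map (ε i) = ν)
    (hind : iIndepFun ε μ) : μ.map (fun ω i => ε i ω) = Measure.pi fun _ => ν := by
  rw [(iIndepFun_iff_map_fun_eq_pi_map fun i => (hε i).aemeasurable).1 hind]
  simp only [hlaw]

theorem measure_errors_weighted_sum_ge [IsProbabilityMeasure ν] (hε : ∀ i, Measurable (ε i))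
    (hlaw : ∀ i, μ.map (ε i) = ν) (hind : iIndepFun ε μ) {f : ℝ → ℝ} (hfm : Measurable f)
    (hf : MemLp f 2 ν) (h0 : ∫ x, f x ∂ν = 0) (w : ℝ) {t : ℝ} (ht : 0 < t) :
    μ {ω | t ≤ |w * ∑ i, f (ε i ω)|} ≤ ENNReal.ofReal ((∫ x, f x ^ 2 ∂ν) * (n * w ^ 2) / t ^ 2) := by
  have h := measure_pi_weighted_sum_ge hf h0 (fun _ : Fin n => w) ht
  rw [← map_errors_eq_pi hε hlaw hind, Measure.map_apply (measurable_pi_lambda _ hε)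
    (measurableSet_le measurable_const (by fun_prop))] at h
  simpa [← Finset.mul_sum] using h

variable {p : ℕ} {X : Ω → Matrix (Fin n) (Fin p) ℝ}

theorem measure_projection_gt [IsProbabilityMeasure ν] (hε : ∀ i, Measurable (ε i))
    (hX : ∀ i j, Measurable fun ω => X ω i j)
    (hlaw : ∀ i, μ.map (ε i) = ν) (hind : iIndepFun ε μ)
    (hXε : IndepFun (fun ω i j => X ω i j) (fun ω i => ε i ω) μ)
    (hf : MemLp (fun x : ℝ => x) 2 ν) (h0 : ∫ x, x ∂ν = 0) {q : ℝ} (hq : 0 < q) :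
    μ {ω | ∃ w, q < 2 * ∑ i, ε i ω * (X ω).mulVec w i - (∑ i, ((X ω).mulVec w i) ^ 2) / 2} ≤
      ENNReal.ofReal (2 * (∫ x, x ^ 2 ∂ν) * p / q) := by
  let B : Set ((Fin n → Fin p → ℝ) × (Fin n → ℝ)) := {z | ∃ w : Fin p → ℝ,
    q < 2 * ∑ i, z.2 i * (Matrix.of z.1).mulVec w i - (∑ i, ((Matrix.of z.1).mulVec w i) ^ 2) / 2}
  have hB : MeasurableSet B := by
    -- The union over `w` is uncountable; it is measurable because each member is open.
    refine IsOpen.measurableSet ?_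
    simp only [B, Set.ofPred_exists]
    refine isOpen_iUnion fun w => isOpen_lt continuous_const ?_
    simp only [Matrix.mulVec, dotProduct, Matrix.of_apply]
    fun_prop
  refine IndepFun.measure_pair_le (U := fun ω i j => X ω i j)
    (measurable_pi_lambda _ fun i => measurable_pi_lambda _ fun j => hX i j)
    (measurable_pi_lambda _ hε) hXε hB MeasurableSet.univ (by simp) fun x _ => ?_
  rw [map_errors_eq_pi hε hlaw hind]
  exact measure_pi_projection_gt hf h0 (Matrix.of x) hq

/-- By independence the design may be frozen at a matrix with entries bounded by `L`; the tail bound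
is then summed over the `p` columns. -/
theorem measure_noise_ge [IsProbabilityMeasure ν] (hε : ∀ i, Measurable (ε i))
    (hX : ∀ i j, Measurable fun ω => X ω i j)
    (hlaw : ∀ i, μ.map (ε i) = ν) (hind : iIndepFun ε μ)
    (hXε : IndepFun (fun ω i j => X ω i j) (fun ω i => ε i ω) μ)
    {a b u L : ℝ} (ha : 0 < a) (hb : 0 ≤ b) (h0 : ∫ x, x ∂ν = 0)
    (hν_exp : ∫⁻ x, ENNReal.ofReal (Real.exp (|x| / a)) ∂ν ≤ ENNReal.ofReal b)
    (hL : ∀ᵐ ω ∂μ, ∀ i j, |X ω i j| ≤ L) (hu0 : 0 ≤ u) (hu : 2 * a * (u * L) ≤ 1) (t : ℝ) :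
    μ {ω | ∃ j, t ≤ |∑ i, X ω i j * ε i ω|} ≤
      ENNReal.ofReal (p * (2 * Real.exp (-(u * t) + 8 * a ^ 2 * b * (u ^ 2 * L ^ 2) * n))) := by
  let B : Set ((Fin n → Fin p → ℝ) × (Fin n → ℝ)) := {z | ∃ j : Fin p, t ≤ |∑ i, z.1 i j * z.2 i|}
  have hB : MeasurableSet B := by
    simp only [B, Set.ofPred_exists]
    refine MeasurableSet.iUnion fun j => IsClosed.measurableSet ?_
    exact isClosed_le continuous_const (by fun_prop)
  let D : Set (Fin n → Fin p → ℝ) := {x | ∀ i j, |x i j| ≤ L}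
  have hD : MeasurableSet D := by
    simp only [D, Set.ofPred_forall]
    refine IsClosed.measurableSet ?_
    exact isClosed_iInter fun i => isClosed_iInter fun j => isClosed_le (by fun_prop) (by fun_prop)
  refine IndepFun.measure_pair_le (U := fun ω i j => X ω i j)
    (measurable_pi_lambda _ fun i => measurable_pi_lambda _ fun j => hX i j)
    (measurable_pi_lambda _ hε) hXε hB hD hL fun x hx => ?_
  rw [map_errors_eq_pi hε hlaw hind]
  have hun : {y : Fin n → ℝ | (x, y) ∈ B} = ⋃ j : Fin p, {e | t ≤ |∑ i, x i j * e i|} := by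
    ext e
    simp [B]
  rw [hun]
  refine (measure_iUnion_fintype_le _ _).trans ((Finset.sum_le_sum fun j _ =>
    measure_pi_abs_weighted_sum_ge_exp ha hb h0 hν_exp hu0 hu (fun i => x i j)
      (fun i => hx i j) t).trans ?_)
  rw [Finset.sum_const, Finset.card_univ, Fintype.card_fin, nsmul_eq_mul,
    ENNReal.ofReal_mul (Nat.cast_nonneg p), ENNReal.ofReal_natCast]

end FixedSampleSize

/-! ### Penalty against noise, and the expansion on good events -/

theorem SparseLower.mono {n p : ℕ} {X : Matrix (Fin n) (Fin p) ℝ} {κ m m' : ℝ}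
    (h : SparseLower X κ m) (hm : m' ≤ m) : SparseLower X κ m' :=
  fun v hv => h v (hv.trans hm)

/-- Converts the deterministic bounds of order `n λ² s` into the rate `s log p`. -/
theorem mul_sq_penalty {n p : ℕ} (hn : 0 < n) (c σ : ℝ) :
    n * (c * σ * √(Real.log p / n)) ^ 2 = c ^ 2 * σ ^ 2 * Real.log p := by
  have hn' : (0 : ℝ) < n := by exact_mod_cast hn
  rw [mul_pow, Real.sq_sqrt (div_nonneg (Real.log_natCast_nonneg p) hn'.le)]
  field_simp

/-- If `log p ≤ n`, the penalty dominates the noise up to probability `2 / p`. -/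
theorem measure_noise_gt_penalty {Ω : Type*} [MeasurableSpace Ω] {μ : Measure Ω}
    [IsProbabilityMeasure μ] {n p : ℕ} {ν : Measure ℝ} [IsProbabilityMeasure ν]
    {ε : Fin n → Ω → ℝ} {X : Ω → Matrix (Fin n) (Fin p) ℝ} (hn : 0 < n) (hp : 0 < p)
    (hpn : Real.log p ≤ n) (hε : ∀ i, Measurable (ε i)) (hX : ∀ i j, Measurable fun ω => X ω i j)
    (hlaw : ∀ i, μ.map (ε i) = ν) (hind : iIndepFun ε μ)
    (hXε : IndepFun (fun ω i j => X ω i j) (fun ω i => ε i ω) μ)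
    {a b L c σ : ℝ} (ha : 0 < a) (hb : 0 ≤ b) (h0 : ∫ x, x ∂ν = 0)
    (hν_exp : ∫⁻ x, ENNReal.ofReal (Real.exp (|x| / a)) ∂ν ≤ ENNReal.ofReal b)
    (hL0 : 0 < L) (hL : ∀ᵐ ω ∂μ, ∀ i j, |X ω i j| ≤ L) (hc : 16 * a * L * (1 + b) ≤ c * σ) :
    μ {ω | ∃ j, n * (c * σ * √(Real.log p / n)) < 4 * |∑ i, X ω i j * ε i ω|} ≤
      ENNReal.ofReal (2 / p) := by
  have hn' : (0 : ℝ) < n := by exact_mod_cast hn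
  have hp' : (0 : ℝ) < p := by exact_mod_cast hp
  have hlp : 0 ≤ Real.log p := Real.log_natCast_nonneg p
  set z := √(Real.log p / n) with hz
  have hz0 : 0 ≤ z := Real.sqrt_nonneg _
  have hzz : z * z * n = Real.log p := by
    rw [hz, Real.mul_self_sqrt (div_nonneg hlp hn'.le)]
    field_simp
  have hz1 : z ≤ 1 := by
    rw [hz, Real.sqrt_le_iff, one_pow, div_le_one hn']
    exact ⟨zero_le_one, hpn⟩
  -- The Chernoff parameter is `u = r z`, proportional to `√(log p / n)`, so both terms of the
  -- exponent are multiples of `log p`; it is admissible because `z ≤ 1`. The lower bound on `c σ`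
  -- makes the exponent at most `-2 (1 + b) log p + 2 b log p`, and one factor `p` is spent on the
  -- union bound.
  set r := 1 / (2 * a * L) with hr
  have hr0 : 0 < r := by positivity
  have hrL : 2 * a * (r * L) = 1 := by rw [hr]; field_simp
  have h := measure_noise_ge (u := r * z) hε hX hlaw hind hXε ha hb h0 hν_exp hL (by positivity)
    (by nlinarith) (n * (c * σ * z) / 4)
  refine (measure_mono ?_).trans (h.trans (ENNReal.ofReal_le_ofReal ?_))
  · rintro ω ⟨j, hj⟩
    exact ⟨j, by linarith⟩
  · have h1 : -(r * z * (n * (c * σ * z) / 4)) + 8 * a ^ 2 * b * ((r * z) ^ 2 * L ^ 2) * n ≤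
        -(2 * Real.log p) := by
      have e1 : r * z * (n * (c * σ * z) / 4) = r * (c * σ) / 4 * (z * z * n) := by ring
      have e2 : 8 * a ^ 2 * b * ((r * z) ^ 2 * L ^ 2) * n =
          2 * b * (2 * a * (r * L)) ^ 2 * (z * z * n) := by ring
      rw [e1, e2, hzz, hrL]
      have h3 : 8 * (1 + b) ≤ r * (c * σ) := by
        calc 8 * (1 + b) = (2 * a * (r * L)) * (8 * (1 + b)) := by rw [hrL, one_mul]
          _ = r * (16 * a * L * (1 + b)) := by ring
          _ ≤ _ := by gcongr
      nlinarith
    have h2 := Real.exp_le_exp.2 h1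
    have h3 : Real.exp (-(2 * Real.log p)) = 1 / (p * p) := by
      rw [Real.exp_neg, two_mul, Real.exp_add, Real.exp_log hp', one_div]
    rw [h3] at h2
    calc p * (2 * Real.exp _) ≤ p * (2 * (1 / (p * p))) := by gcongr
      _ = 2 / p := by field_simp

/-- If `n < log p`, the penalty dominates the noise deterministically. -/
theorem noise_le_penalty_of_lt_log {n p : ℕ} (hn : 0 < n) (hpn : n < Real.log p)
    {X : Matrix (Fin n) (Fin p) ℝ} {e : Fin n → ℝ} {c σ κ₂ m : ℝ} (hκ₂ : 0 ≤ κ₂) (hσ : 0 ≤ σ)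
    (hc0 : 0 ≤ c) (hc : 32 * κ₂ ≤ c ^ 2) (hup : SparseUpper X κ₂ m) (hm : 1 ≤ m)
    (he : ∑ i, e i ^ 2 ≤ 2 * σ ^ 2 * n) (j : Fin p) :
    4 * |∑ i, X i j * e i| ≤ n * (c * σ * √(Real.log p / n)) := by
  have hn' : (0 : ℝ) < n := by exact_mod_cast hn
  -- A single column suffices: `⟨X_j, e⟩² ≤ n κ₂ ‖e‖² ≤ 2 κ₂ σ² n²`, and the factor 16 from the
  -- square of 4 gives the 32 in `hc`.
  have h1 := hup.sum_sq_le hκ₂ {j} (by simpa using hm) e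
  rw [Finset.sum_singleton] at h1
  have h2 : 1 ≤ √(Real.log p / n) := by
    rw [Real.one_le_sqrt, le_div_iff₀ hn', one_mul]
    exact hpn.le
  have h3 : 4 * |∑ i, X i j * e i| ≤ n * (c * σ) := by
    refine abs_le_of_sq_le_sq' (a := 4 * |∑ i, X i j * e i|) ?_ (by positivity) |>.2
    calc (4 * |∑ i, X i j * e i|) ^ 2 = 16 * (∑ i, X i j * e i) ^ 2 := by
          rw [mul_pow, sq_abs]; norm_num
      _ ≤ 16 * (n * κ₂ * (2 * σ ^ 2 * n)) := by
          have : n * κ₂ * ∑ i, e i ^ 2 ≤ n * κ₂ * (2 * σ ^ 2 * n) := by gcongr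
          linarith
      _ = (32 * κ₂) * (n ^ 2 * σ ^ 2) := by ring
      _ ≤ c ^ 2 * (n ^ 2 * σ ^ 2) := by gcongr
      _ = _ := by ring
  calc _ ≤ n * (c * σ) * 1 := by linarith
    _ ≤ n * (c * σ) * √(Real.log p / n) := by gcongr
    _ = _ := by ring

/-- The support size is bounded in two ways because it enters twice. As the factor of the
fluctuation it needs a bound `A` free of `log p`, so that `A / n` tends to zero even if `s log p /
n` does not; in the additive error the larger `B` is harmless. -/
theorem plugInVariance_expansion {n p : ℕ} (hn : 0 < n) (X : Matrix (Fin n) (Fin p) ℝ)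
    (y e : Fin n → ℝ) (v : Fin p → ℝ) {t K₁ K₂ A B : ℝ} (ht : 0 ≤ t)
    (hR : |residualSS X y v - ∑ i, e i ^ 2| ≤ K₂ * B) (hv : 2 * numNonzero v ≤ n)
    (hK₁ : 0 ≤ K₁) (hK₂ : 0 ≤ K₂) (hA : 0 ≤ A) (hB : 0 ≤ B)
    (hv1 : (numNonzero v : ℝ) ≤ K₁ * A) (hv2 : (numNonzero v : ℝ) ≤ K₁ * B) :
    |plugInVariance X y v - t - ((∑ i, e i ^ 2) / n - t)| ≤
      2 * (K₁ + K₂ + K₁ * t) * A / n * |(∑ i, e i ^ 2) / n - t| +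
        2 * (K₁ + K₂ + K₁ * t) * B / n := by
  have hn' : (0 : ℝ) < n := by exact_mod_cast hn
  refine (plugInVariance_sub_abs_le hn X y e v t ht hR hv).trans (add_le_add ?_ ?_)
  · have h1 : 0 ≤ (K₂ + K₁ * t) * A := by positivity
    have h2 : 2 * (numNonzero v : ℝ) ≤ 2 * (K₁ + K₂ + K₁ * t) * A := by linarith
    gcongr
  · have h1 : 0 ≤ K₁ * B := by positivity
    have h2 : (numNonzero v : ℝ) * t ≤ K₁ * B * t := by gcongr
    have h3 : 2 * (K₂ * B + (numNonzero v : ℝ) * t) ≤ 2 * (K₁ + K₂ + K₁ * t) * B := by linarith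
    gcongr

/-- The expansion of the plug-in variance on the intersection of the good events. -/
theorem plugInVariance_lasso_expansion {n p N : ℕ} {X : Matrix (Fin n) (Fin p) ℝ}
    {β : Fin p → ℝ} {e : Fin n → ℝ} {v : Fin p → ℝ} {c σ κ₁ κ₂ q : ℝ}
    (hn : 3 ≤ n) (hσ : 0 < σ) (hc : 0 < c) (hc2 : 32 * κ₂ ≤ c ^ 2)
    (hκ₁ : 0 < κ₁) (hκ₂ : 0 ≤ κ₂) (hN : 144 * κ₂ ≤ N * κ₁)
    (hlogN : (N : ℝ) + 2 ≤ Real.log n) (hsn : 2 * (numNonzero β * N + 1) ≤ n)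
    (hq : Real.log n ≤ q) (hlogn : 2 * Real.log n ≤ n)
    (hlasso : IsLasso X (fun i => X.mulVec β i + e i) (c * σ * √(Real.log p / n)) v)
    (hlow : SparseLower X κ₁ (numNonzero β * Real.log n))
    (hup : SparseUpper X κ₂ (numNonzero β + min n p : ℕ))
    (he : ∑ i, e i ^ 2 ≤ 2 * σ ^ 2 * n)
    (hproj : (p : ℝ) ≤ Real.log n →
      ∀ w, 2 * ∑ i, e i * X.mulVec w i - (∑ i, (X.mulVec w i) ^ 2) / 2 ≤ q)
    (hnoise : Real.log n < p → Real.log p ≤ n →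
      ∀ j, 4 * |∑ i, X i j * e i| ≤ n * (c * σ * √(Real.log p / n))) :
    |plugInVariance X (fun i => X.mulVec β i + e i) v - σ ^ 2 - ((∑ i, e i ^ 2) / n - σ ^ 2)| ≤
      2 * ((144 * κ₂ / κ₁ + 1) + (21 * (c ^ 2 * σ ^ 2 / κ₁) + 7) +
          (144 * κ₂ / κ₁ + 1) * σ ^ 2) * (q + numNonzero β) / n *
          |(∑ i, e i ^ 2) / n - σ ^ 2| +
        2 * ((144 * κ₂ / κ₁ + 1) + (21 * (c ^ 2 * σ ^ 2 / κ₁) + 7) +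
          (144 * κ₂ / κ₁ + 1) * σ ^ 2) * (q + numNonzero β * Real.log p) / n := by
  have hn0 : 0 < n := by omega
  have hn' : (0 : ℝ) < n := by exact_mod_cast hn0
  have hlp : 0 ≤ Real.log p := Real.log_natCast_nonneg p
  have hlogn1 : 1 ≤ Real.log n := by
    have : (0 : ℝ) ≤ N := Nat.cast_nonneg N
    linarith
  have hq0 : 0 ≤ q := by linarith
  set s : ℝ := (numNonzero β : ℝ) with hs
  have hs0 : 0 ≤ s := Nat.cast_nonneg _
  have hpen := mul_sq_penalty (p := p) hn0 c σ
  have hA : 0 ≤ q + s := by linarith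
  have hB : 0 ≤ q + s * Real.log p := by positivity
  have hK₁ : 0 ≤ 144 * κ₂ / κ₁ := by positivity
  have hc' : 0 ≤ c ^ 2 * σ ^ 2 / κ₁ := by positivity
  rcases le_or_gt (p : ℝ) (Real.log n) with hp | hp
  · have hpv : (numNonzero v : ℝ) ≤ p := by
      have : numNonzero v ≤ p :=
        (Finset.card_le_univ (Finset.univ.filter fun j => v j ≠ 0)).trans (by simp)
      exact_mod_cast this
    have hvq : (numNonzero v : ℝ) ≤ q := by linarith
    have hv2 : 2 * numNonzero v ≤ n := by
      have : 2 * (numNonzero v : ℝ) ≤ n := by linarith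
      exact_mod_cast this
    -- If `s ≥ 1` then `p ≤ log n ≤ s log n`, so the sparse lower bound covers all vectors.
    have hR := lasso_low_dim hn0 (by positivity) hlasso hκ₁ (fun hne => hlow.mono (by
      have h1 : (1 : ℝ) ≤ s := Nat.one_le_cast.2 (Nat.one_le_iff_ne_zero.2 hne)
      calc (p : ℝ) ≤ 1 * Real.log n := by linarith
        _ ≤ s * Real.log n := by gcongr)) (hproj hp)
    rw [hpen] at hR
    refine plugInVariance_expansion hn0 X _ e v (by positivity) (hR.trans ?_) hv2 (by positivity)
      (by positivity) hA hB ?_ ?_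
    · have h1 : c ^ 2 * σ ^ 2 * Real.log p * s / κ₁ =
          c ^ 2 * σ ^ 2 / κ₁ * (s * Real.log p) := by ring
      rw [← hs, h1]
      have h2 : 0 ≤ c ^ 2 * σ ^ 2 / κ₁ * q := by positivity
      have h3 : 0 ≤ c ^ 2 * σ ^ 2 / κ₁ * (s * Real.log p) := by positivity
      have h4 : 0 ≤ s * Real.log p := by positivity
      linarith
    · have : 0 ≤ 144 * κ₂ / κ₁ * (q + s) := by positivity
      linarith
    · have : 0 ≤ 144 * κ₂ / κ₁ * (q + s * Real.log p) := by positivity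
      have : 0 ≤ s * Real.log p := by positivity
      linarith
  · have hp1 : (1 : ℝ) < p := lt_of_le_of_lt hlogn1 hp
    have hp0 : 0 < p := by
      have : 1 < p := by exact_mod_cast hp1
      omega
    have hlp0 : 0 < Real.log p := Real.log_pos hp1
    have hlam : 0 < c * σ * √(Real.log p / n) := by
      have : 0 < √(Real.log p / n) := Real.sqrt_pos.2 (by positivity)
      positivity
    -- `p ≥ 3` gives `log p ≥ 1`, hence `s ≤ s log p`, which the additive error requires.
    have hp3 : 3 ≤ p := by
      have h0 : (0 : ℝ) ≤ N := Nat.cast_nonneg N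
      have : 2 < p := by
        have : (2 : ℝ) < p := by linarith
        exact_mod_cast this
      omega
    have hlog1 : 1 ≤ Real.log p := by
      rw [Real.le_log_iff_exp_le (by positivity)]
      have : (3 : ℝ) ≤ p := by exact_mod_cast hp3
      linarith [Real.exp_one_lt_three]
    have hnz : ∀ j, 4 * |∑ i, X i j * e i| ≤ n * (c * σ * √(Real.log p / n)) := by
      rcases le_or_gt (Real.log p) n with h1 | h1
      · exact hnoise hp h1
      · refine noise_le_penalty_of_lt_log hn0 h1 hκ₂ hσ.le hc.le hc2 hup ?_ he
        have : 1 ≤ numNonzero β + min n p := by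
          have : 1 ≤ min n p := le_min hn0 hp0
          omega
        exact_mod_cast this
    -- `k = s N + 1`: the multiple `N` of `s` meets the condition with 144, and the 1 keeps `k`
    -- positive when `s = 0`. For `s ≥ 1`, `s + k ≤ s (N + 2) ≤ s log n`, the level at which the
    -- lower eigenvalue is controlled.
    obtain ⟨h1, h2, h3⟩ := lasso_oracle (k := numNonzero β * N + 1) hn0 hlam hlasso hκ₁ hκ₂
      (by omega) (by omega) (fun hne => hlow.mono (by
        have h1 : (1 : ℝ) ≤ s := Nat.one_le_cast.2 (Nat.one_le_iff_ne_zero.2 hne)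
        push_cast
        rw [← hs]
        calc s + (s * N + 1) ≤ s * (N + 2) := by linarith
          _ ≤ s * Real.log n := by gcongr)) hup (by
        push_cast
        rw [← hs]
        calc 144 * s * κ₂ = s * (144 * κ₂) := by ring
          _ ≤ s * (N * κ₁) := by gcongr
          _ ≤ (s * N + 1) * κ₁ := by linarith) hnz
    have hvs : (numNonzero v : ℝ) ≤ 144 * κ₂ / κ₁ * s := by
      rw [div_mul_eq_mul_div, le_div_iff₀ hκ₁]
      exact h1
    have hslog : s ≤ s * Real.log p := le_mul_of_one_le_right hs0 hlog1
    have hvs' : 144 * κ₂ / κ₁ * s ≤ 144 * κ₂ / κ₁ * (s * Real.log p) := by gcongr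
    have hq1 : 0 ≤ 144 * κ₂ / κ₁ * q := by positivity
    have hR : |residualSS X (fun i => X.mulVec β i + e i) v - ∑ i, e i ^ 2| ≤
        21 * (c ^ 2 * σ ^ 2 / κ₁) * (s * Real.log p) := by
      rw [hpen] at h3
      have : 21 * (c ^ 2 * σ ^ 2 / κ₁) * (s * Real.log p) =
          21 * (c ^ 2 * σ ^ 2 * Real.log p * s) / κ₁ := by ring
      rw [this, le_div_iff₀ hκ₁, mul_comm]
      exact h3
    refine plugInVariance_expansion hn0 X _ e v (by positivity) (hR.trans ?_) (by omega)
      (by positivity) (by positivity) hA hB ?_ ?_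
    · have h5 : 0 ≤ 21 * (c ^ 2 * σ ^ 2 / κ₁) * q := by positivity
      have h6 : 0 ≤ s * Real.log p := by positivity
      linarith
    · linarith
    · linarith

/-! ### The expansion with probability tending to one -/

theorem tendsto_log_natCast_div_rpow {r : ℝ} (hr : 0 < r) :
    Tendsto (fun n : ℕ => Real.log n / (n : ℝ) ^ r) atTop (𝓝 0) :=
  ((isLittleO_log_rpow_atTop hr).tendsto_div_nhds_zero).comp tendsto_natCast_atTop_atTop

theorem eventually_log_natCast_le_rpow {r : ℝ} (hr : 0 < r) (C : ℝ) :
    ∀ᶠ n : ℕ in atTop, C * Real.log n ≤ (n : ℝ) ^ r := by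
  have h := (tendsto_log_natCast_div_rpow hr).const_mul C
  rw [mul_zero] at h
  filter_upwards [h.eventually_le_const one_pos, eventually_gt_atTop 0] with n h1 hn
  have hn' : (0 : ℝ) < n := by exact_mod_cast hn
  rwa [← mul_div_assoc, div_le_one (Real.rpow_pos_of_pos hn' r)] at h1

theorem tendsto_div_natCast_of_isLittleO_rpow {s : ℕ → ℝ} {r : ℝ} (hr : r ≤ 1)
    (h : s =o[atTop] fun n : ℕ => (n : ℝ) ^ r) : Tendsto (fun n => s n / n) atTop (𝓝 0) := by
  refine (h.trans_isBigO ?_).tendsto_div_nhds_zero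
  refine IsBigO.of_bound 1 ?_
  filter_upwards [eventually_ge_atTop 1] with n hn
  have hn' : (1 : ℝ) ≤ n := by exact_mod_cast hn
  rw [Real.norm_of_nonneg (by positivity), Real.norm_of_nonneg (by positivity), one_mul]
  simpa using Real.rpow_le_rpow_of_exponent_le hn' hr

theorem integral_sq_sub_eq_zero {ν : Measure ℝ} [IsProbabilityMeasure ν] {t : ℝ}
    (hf : MemLp (fun x : ℝ => x) 2 ν) (hν_var : ∫ x, x ^ 2 ∂ν = t) : ∫ x, (x ^ 2 - t) ∂ν = 0 := by
  rw [integral_sub hf.integrable_sq (integrable_const _), hν_var]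
  simp

/-- The plug-in variance agrees with the mean of the squared errors up to a small relative error
and an additive error of the order `(n ^ (1 / 4) + s log p) / n`, with probability tending to
one. -/
theorem tendsto_measure_plugInVariance_expansion {ν : Measure ℝ} [IsProbabilityMeasure ν]
    {σ a b L kmin kmax : ℝ} (hσ : 0 < σ) (hν_sq : MemLp (fun x : ℝ => x) 2 ν)
    (hν_mean : ∫ x, x ∂ν = 0) (hν_var : ∫ x, x ^ 2 ∂ν = σ ^ 2) (ha : 0 < a) (hb : 0 < b)
    (hν_exp : ∫⁻ x, ENNReal.ofReal (Real.exp (|x| / a)) ∂ν ≤ ENNReal.ofReal b)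
    (hL0 : 0 < L) (hkmin : 0 < kmin) (hkmax : 0 < kmax)
    {Ω : Type*} [MeasurableSpace Ω] {μ : Measure Ω} [IsProbabilityMeasure μ]
    {p : ℕ → ℕ} {β : ∀ n, Fin (p n) → ℝ} {ε : ∀ n, Fin n → Ω → ℝ}
    {X : ∀ n, Ω → Matrix (Fin n) (Fin (p n)) ℝ}
    (hε : ∀ n i, Measurable (ε n i)) (hX : ∀ n i j, Measurable fun ω => X n ω i j)
    (hlaw : ∀ n i, μ.map (ε n i) = ν) (hind : ∀ n, iIndepFun (ε n) μ)
    (hXε : ∀ n, IndepFun (fun ω (i : Fin n) (j : Fin (p n)) => X n ω i j)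
      (fun ω (i : Fin n) => ε n i ω) μ)
    (hL : ∀ n, ∀ᵐ ω ∂μ, ∀ i j, |X n ω i j| ≤ L)
    (hlow : ∀ᵐ ω ∂μ, ENNReal.ofReal kmin ≤
      liminf (fun n : ℕ => phiMin (X n ω) ((numNonzero (β n) : ℝ) * Real.log n)) atTop)
    (hup : ∀ᵐ ω ∂μ, limsup (fun n : ℕ =>
      phiMax (X n ω) ((numNonzero (β n) + min n (p n) : ℕ) : ℝ)) atTop ≤ ENNReal.ofReal kmax)
    (hs : Tendsto (fun n => (numNonzero (β n) : ℝ) / n) atTop (𝓝 0))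
    {c : ℝ} (hc0 : 0 < c) (hc1 : 16 * a * L * (1 + b) ≤ c * σ) (hc2 : 64 * kmax ≤ c ^ 2)
    {βhat : ∀ n, Ω → Fin (p n) → ℝ}
    (hlasso : ∀ n, ∀ᵐ ω ∂μ, IsLasso (X n ω) (fun i => (X n ω).mulVec (β n) i + ε n i ω)
      (c * σ * √(Real.log (p n) / n)) (βhat n ω)) :
    ∃ K : ℝ, 0 ≤ K ∧ Tendsto (fun n : ℕ => μ {ω |
      K * ((n : ℝ) ^ (1 / 4 : ℝ) + numNonzero (β n)) / n *
          |(∑ i, ε n i ω ^ 2) / n - σ ^ 2| +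
        K * ((n : ℝ) ^ (1 / 4 : ℝ) + numNonzero (β n) * Real.log (p n)) / n <
      |plugInVariance (X n ω) (fun i => (X n ω).mulVec (β n) i + ε n i ω) (βhat n ω) - σ ^ 2 -
        ((∑ i, ε n i ω ^ 2) / n - σ ^ 2)|}) atTop (𝓝 0) := by
  set κ₁ := kmin / 2 with hκ₁
  set κ₂ := 2 * kmax with hκ₂
  have hκ₁0 : 0 < κ₁ := by positivity
  have hκ₂0 : 0 < κ₂ := by positivity
  obtain ⟨N, hN⟩ := exists_nat_ge (144 * κ₂ / κ₁)
  rw [div_le_iff₀ hκ₁0] at hN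
  refine ⟨2 * ((144 * κ₂ / κ₁ + 1) + (21 * (c ^ 2 * σ ^ 2 / κ₁) + 7) +
    (144 * κ₂ / κ₁ + 1) * σ ^ 2), by positivity, ?_⟩
  set V := ∫ x, (x ^ 2 - σ ^ 2) ^ 2 ∂ν with hV
  set G : ℕ → Set Ω := fun n => {ω | SparseLower (X n ω) κ₁ ((numNonzero (β n) : ℝ) * Real.log n) ∧
    SparseUpper (X n ω) κ₂ ((numNonzero (β n) + min n (p n) : ℕ) : ℝ)} with hG
  have hGt : Tendsto (fun n => μ (G n)ᶜ) atTop (𝓝 0) :=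
    tendsto_measure_sparse_compl hX hkmin hkmax hlow hup
  -- Off this event the mean of the squared errors is below `2 σ²`.
  set E : ℕ → Set Ω := fun n =>
    {ω | σ ^ 2 ≤ |(1 / (n : ℝ)) * ∑ i, (ε n i ω ^ 2 - σ ^ 2)|} with hE
  have hEle : ∀ᶠ n : ℕ in atTop,
      μ (E n) ≤ ENNReal.ofReal (V * (n * (1 / (n : ℝ)) ^ 2) / (σ ^ 2) ^ 2) :=
    Eventually.of_forall fun n => measure_errors_weighted_sum_ge (hε n) (hlaw n) (hind n)
      (f := fun x => x ^ 2 - σ ^ 2) (by fun_prop) (memLp_sq_sub_of_exp ha hν_exp _)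
      (integral_sq_sub_eq_zero hν_sq hν_var) _ (by positivity)
  have hElim : Tendsto (fun n : ℕ =>
      ENNReal.ofReal (V * (n * (1 / (n : ℝ)) ^ 2) / (σ ^ 2) ^ 2)) atTop (𝓝 0) := by
    rw [← ENNReal.ofReal_zero]
    refine ENNReal.tendsto_ofReal ?_
    have h1 : Tendsto (fun n : ℕ => V / (σ ^ 2) ^ 2 * (1 / (n : ℝ))) atTop (𝓝 0) := by
      simpa using tendsto_one_div_atTop_nhds_zero_nat.const_mul (V / (σ ^ 2) ^ 2)
    refine h1.congr fun n => ?_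
    rcases Nat.eq_zero_or_pos n with h | h
    · simp [h]
    · field_simp
  -- The condition on `p n` is part of the event, so no regime for `p` has to hold along the whole
  -- sequence. The exponent `1 / 4` is one choice between `0` and `1 / 2`: it beats `log n` in
  -- Markov's inequality and is negligible against `√n`.
  set Q : ℕ → Set Ω := fun n => {ω | (p n : ℝ) ≤ Real.log n ∧ ∃ w, (n : ℝ) ^ (1 / 4 : ℝ) <
    2 * ∑ i, ε n i ω * (X n ω).mulVec w i - (∑ i, ((X n ω).mulVec w i) ^ 2) / 2} with hQ
  have hQle : ∀ᶠ n : ℕ in atTop, μ (Q n) ≤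
      ENNReal.ofReal (2 * σ ^ 2 * (Real.log n / (n : ℝ) ^ (1 / 4 : ℝ))) := by
    filter_upwards [eventually_gt_atTop 0] with n hn
    have hn' : (0 : ℝ) < n := by exact_mod_cast hn
    by_cases hp : (p n : ℝ) ≤ Real.log n
    · have h := measure_projection_gt (hε n) (hX n) (hlaw n) (hind n) (hXε n) hν_sq hν_mean
        (Real.rpow_pos_of_pos hn' (1 / 4))
      refine (measure_mono fun ω hω => hω.2).trans (h.trans (ENNReal.ofReal_le_ofReal ?_))
      rw [hν_var, mul_div_assoc]
      gcongr
    · have : Q n = ∅ := by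
        ext ω
        simp [hQ, hp]
      rw [this, measure_empty]
      exact zero_le
  have hQlim : Tendsto (fun n : ℕ =>
      ENNReal.ofReal (2 * σ ^ 2 * (Real.log n / (n : ℝ) ^ (1 / 4 : ℝ)))) atTop (𝓝 0) := by
    rw [← ENNReal.ofReal_zero]
    refine ENNReal.tendsto_ofReal ?_
    simpa using (tendsto_log_natCast_div_rpow (r := 1 / 4) (by norm_num)).const_mul (2 * σ ^ 2)
  set R : ℕ → Set Ω := fun n => {ω | Real.log n < p n ∧ Real.log (p n) ≤ n ∧
    ∃ j, n * (c * σ * √(Real.log (p n) / n)) < 4 * |∑ i, X n ω i j * ε n i ω|} with hR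
  have hRle : ∀ᶠ n : ℕ in atTop, μ (R n) ≤ ENNReal.ofReal (2 / Real.log n) := by
    filter_upwards [eventually_gt_atTop 1] with n hn
    have hlog : 0 < Real.log n := Real.log_pos (by exact_mod_cast hn)
    by_cases hp : Real.log n < p n ∧ Real.log (p n) ≤ n
    · have hp0 : 0 < p n := by
        have : (0 : ℝ) < p n := hlog.trans hp.1
        exact_mod_cast this
      have h := measure_noise_gt_penalty (by omega) hp0 hp.2 (hε n) (hX n) (hlaw n) (hind n)
        (hXε n) ha hb.le hν_mean hν_exp hL0 (hL n) hc1
      refine (measure_mono fun ω hω => hω.2.2).trans (h.trans (ENNReal.ofReal_le_ofReal ?_))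
      have := hp.1.le
      gcongr
    · have : R n = ∅ := by
        ext ω
        simp only [hR, Set.mem_ofPred_eq, Set.mem_empty_iff_false, iff_false]
        exact fun h => hp ⟨h.1, h.2.1⟩
      rw [this, measure_empty]
      exact zero_le
  have hlogt : Tendsto (fun n : ℕ => Real.log n) atTop atTop :=
    Real.tendsto_log_atTop.comp tendsto_natCast_atTop_atTop
  have hRlim : Tendsto (fun n : ℕ => ENNReal.ofReal (2 / Real.log n)) atTop (𝓝 0) := by
    rw [← ENNReal.ofReal_zero]
    exact ENNReal.tendsto_ofReal (hlogt.const_div_atTop 2)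
  have hsum := ((hGt.add hElim).add hQlim).add hRlim
  simp only [add_zero] at hsum
  refine tendsto_of_tendsto_of_tendsto_of_le_of_le' tendsto_const_nhds hsum
    (Eventually.of_forall fun _ => zero_le) ?_
  have hsn : ∀ᶠ n : ℕ in atTop, 2 * (numNonzero (β n) * N + 1) ≤ n := by
    have h1 := (hs.const_mul (4 * (N : ℝ)))
    rw [mul_zero] at h1
    filter_upwards [h1.eventually_le_const one_pos, eventually_ge_atTop 4] with n h2 hn
    have hn' : (4 : ℝ) ≤ n := by exact_mod_cast hn
    rw [← mul_div_assoc, div_le_one (by linarith)] at h2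
    have h3 : 2 * ((numNonzero (β n) : ℝ) * N + 1) ≤ n := by linarith
    exact_mod_cast h3
  filter_upwards [hEle, hQle, hRle, hsn, eventually_ge_atTop 3,
    hlogt.eventually_ge_atTop ((N : ℝ) + 2),
    eventually_log_natCast_le_rpow (r := 1 / 4) (by norm_num) 1,
    eventually_log_natCast_le_rpow (r := 1) (by norm_num) 2] with n h1 h2 h3 h4 h5 h6 h7 h8
  rw [one_mul] at h7
  rw [Real.rpow_one] at h8
  refine le_trans ?_ (add_le_add (add_le_add (add_le_add le_rfl h1) h2) h3)
  refine le_trans ?_ ((measure_union_le _ _).trans (add_le_add ((measure_union_le _ _).trans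
    (add_le_add (measure_union_le _ _) le_rfl)) le_rfl))
  -- The inclusion holds only almost everywhere, since minimality of the estimate is an almost sure
  -- assumption.
  refine measure_mono_ae ?_
  filter_upwards [hlasso n] with ω hω hbad
  by_contra hgood
  have hgood' : ω ∈ G n ∧ ω ∉ E n ∧ ω ∉ Q n ∧ ω ∉ R n := by
    have : ω ∉ (G n)ᶜ ∪ E n ∪ Q n ∪ R n := hgood
    simp only [Set.mem_union, Set.mem_compl_iff, not_or, not_not] at this
    tauto
  obtain ⟨g1, g2, g3, g4⟩ := hgood'
  have hn' : (0 : ℝ) < n := by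
    have : 0 < n := by omega
    exact_mod_cast this
  refine absurd hbad (not_lt.2 ?_)
  refine plugInVariance_lasso_expansion (e := fun i => ε n i ω) (q := (n : ℝ) ^ (1 / 4 : ℝ)) h5 hσ
    hc0 (by linarith) hκ₁0 hκ₂0.le hN h6 h4 h7 h8 hω g1.1 g1.2 ?_ ?_ ?_
  · have h9 : |(1 / (n : ℝ)) * ∑ i, (ε n i ω ^ 2 - σ ^ 2)| < σ ^ 2 := not_le.1 g2
    have h10 := (abs_lt.1 h9).2
    rw [Finset.sum_sub_distrib, one_div, ← div_eq_inv_mul, div_lt_iff₀ hn'] at h10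
    simp only [Finset.sum_const, Finset.card_univ, Fintype.card_fin, nsmul_eq_mul] at h10
    linarith
  · intro hp w
    by_contra hlt
    exact g3 ⟨hp, w, not_le.1 hlt⟩
  · intro hp1 hp2 j
    by_contra hlt
    exact g4 ⟨hp1, hp2, j, not_le.1 hlt⟩

/-- In the noiseless case the residuals of the unpenalized estimator vanish. -/
theorem plugInVariance_expansion_noiseless {ν : Measure ℝ}
    (hν_sq : MemLp (fun x : ℝ => x) 2 ν) (hν_var : ∫ x, x ^ 2 ∂ν = 0)
    {Ω : Type*} [MeasurableSpace Ω] {μ : Measure Ω} {n p : ℕ} {β : Fin p → ℝ}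
    {ε : Fin n → Ω → ℝ} {X : Ω → Matrix (Fin n) (Fin p) ℝ} (hn : 0 < n)
    (hε : ∀ i, Measurable (ε i)) (hlaw : ∀ i, μ.map (ε i) = ν)
    {βhat : Ω → Fin p → ℝ}
    (hlasso : ∀ᵐ ω ∂μ, IsLasso (X ω) (fun i => (X ω).mulVec β i + ε i ω) 0 (βhat ω)) :
    ∀ᵐ ω ∂μ, plugInVariance (X ω) (fun i => (X ω).mulVec β i + ε i ω) (βhat ω) = 0 ∧
      ∑ i, ε i ω ^ 2 = 0 := by
  have hn' : (0 : ℝ) < n := by exact_mod_cast hn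
  have h0 : ∀ᵐ x ∂ν, x ^ 2 = 0 :=
    (integral_eq_zero_iff_of_nonneg (fun x => sq_nonneg x) hν_sq.integrable_sq).1 hν_var
  have h1 : ∀ᵐ ω ∂μ, ∀ i, ε i ω ^ 2 = 0 := by
    rw [ae_all_iff]
    intro i
    rw [← hlaw i] at h0
    exact ae_of_ae_map (hε i).aemeasurable h0
  filter_upwards [h1, hlasso] with ω h2 h3
  have h4 : ∑ i, ε i ω ^ 2 = 0 := Finset.sum_eq_zero fun i _ => h2 i
  refine ⟨?_, h4⟩
  have h5 := h3 β
  unfold lassoObjective at h5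
  rw [zero_mul, zero_mul, add_zero, add_zero] at h5
  have h6 := le_of_mul_le_mul_left h5 (by positivity)
  have h7 : residualSS (X ω) (fun i => (X ω).mulVec β i + ε i ω) β = 0 := by
    simpa [residualSS] using h4
  have h8 : 0 ≤ residualSS (X ω) (fun i => (X ω).mulVec β i + ε i ω) (βhat ω) :=
    Finset.sum_nonneg fun _ _ => sq_nonneg _
  unfold plugInVariance
  rw [le_antisymm (h6.trans h7.le) h8, mul_zero]

/-! ### From the expansion to the rate and the limit law -/

theorem tendsto_rpow_quarter_add_div {s : ℕ → ℝ} (hs : Tendsto (fun n => s n / n) atTop (𝓝 0))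
    (K : ℝ) :
    Tendsto (fun n : ℕ => K * ((n : ℝ) ^ (1 / 4 : ℝ) + s n) / n) atTop (𝓝 0) := by
  have h1 : Tendsto (fun n : ℕ => (n : ℝ) ^ (1 / 4 : ℝ) / n) atTop (𝓝 0) := by
    refine (((tendsto_rpow_neg_atTop (y := 3 / 4) (by norm_num)).comp
      tendsto_natCast_atTop_atTop)).congr' ?_
    filter_upwards [eventually_gt_atTop 0] with n hn
    have hn' : (0 : ℝ) < n := by exact_mod_cast hn
    rw [Function.comp_apply, ← Real.rpow_sub_one hn'.ne']
    norm_num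
  have h2 := (h1.add hs).const_mul K
  rw [add_zero, mul_zero] at h2
  exact h2.congr fun n => by ring

theorem rpow_quarter_div_le {n : ℕ} (hn : 1 ≤ n) :
    (n : ℝ) ^ (1 / 4 : ℝ) / n ≤ (n : ℝ) ^ (-(1 / 2) : ℝ) := by
  have hn' : (1 : ℝ) ≤ n := by exact_mod_cast hn
  rw [← Real.rpow_sub_one (by positivity)]
  exact Real.rpow_le_rpow_of_exponent_le hn' (by norm_num)

section Limit

variable {ν : Measure ℝ} [IsProbabilityMeasure ν] {t : ℝ}
  {Ω : Type*} [MeasurableSpace Ω] {μ : Measure Ω} [IsProbabilityMeasure μ]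
  {ε : ∀ n : ℕ, Fin n → Ω → ℝ} {Z : ℕ → Ω → ℝ} {s ℓ : ℕ → ℝ} {K : ℝ}

theorem mean_sq_sub_eq {n : ℕ} (hn : 0 < n) (e : Fin n → ℝ) (t : ℝ) :
    (∑ i, e i ^ 2) / n - t = (1 / (n : ℝ)) * ∑ i, (e i ^ 2 - t) := by
  have hn' : (n : ℝ) ≠ 0 := by
    have : n ≠ 0 := by omega
    exact_mod_cast this
  rw [Finset.sum_sub_distrib]
  simp only [Finset.sum_const, Finset.card_univ, Fintype.card_fin, nsmul_eq_mul]
  field_simp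

/-- A variable close to the centred mean of the squared errors has its order in probability. -/
theorem isBigOInProb_of_expansion (hε : ∀ n i, Measurable (ε n i))
    (hlaw : ∀ n i, μ.map (ε n i) = ν) (hind : ∀ n, iIndepFun (ε n) μ)
    (hf : MemLp (fun x : ℝ => x ^ 2 - t) 2 ν) (h0 : ∫ x, (x ^ 2 - t) ∂ν = 0)
    (hK : 0 ≤ K) (hs : Tendsto (fun n => s n / n) atTop (𝓝 0))
    (h : Tendsto (fun n : ℕ => μ {ω |
      K * ((n : ℝ) ^ (1 / 4 : ℝ) + s n) / n * |(∑ i, ε n i ω ^ 2) / n - t| +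
        K * ((n : ℝ) ^ (1 / 4 : ℝ) + s n * ℓ n) / n <
      |Z n ω - ((∑ i, ε n i ω ^ 2) / n - t)|}) atTop (𝓝 0)) :
    IsBigOInProb μ Z (fun n => max ((n : ℝ) ^ (-(1 / 2) : ℝ)) (s n * ℓ n / n)) := by
  intro δ hδ
  set V := ∫ x, (x ^ 2 - t) ^ 2 ∂ν with hV
  have hV0 : 0 ≤ V := integral_nonneg fun x => sq_nonneg _
  -- Chosen so that Chebyshev's bound `V / A²` is at most `δ / 2`; the 1 keeps `A` positive if `V =
  -- 0`.
  set A := √(2 * V / δ) + 1 with hA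
  have hA0 : 0 < A := by positivity
  have hVA : V / A ^ 2 ≤ δ / 2 := by
    have h1 : 2 * V / δ ≤ A ^ 2 := by
      calc 2 * V / δ = √(2 * V / δ) ^ 2 := (Real.sq_sqrt (by positivity)).symm
        _ ≤ A ^ 2 := pow_le_pow_left₀ (Real.sqrt_nonneg _) (by rw [hA]; linarith) 2
    rw [div_le_iff₀ hδ] at h1
    rw [div_le_iff₀ (by positivity)]
    linarith
  -- Once the relative error is at most 1, `|Z| ≤ 2 |W|` plus the additive error. The first is at
  -- most `2 A r`, and the second at most `2 K` times the maximum, because `n ^ (1/4) / n ≤ r`.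
  refine ⟨2 * A + 2 * K, ?_⟩
  have hδ2 : (0 : ℝ≥0∞) < ENNReal.ofReal (δ / 2) := ENNReal.ofReal_pos.2 (by positivity)
  filter_upwards [h.eventually_le_const hδ2, eventually_ge_atTop 1,
    (tendsto_rpow_quarter_add_div hs K).eventually_le_const one_pos] with n hbad hn hd
  have hn' : (1 : ℝ) ≤ n := by exact_mod_cast hn
  set r := (n : ℝ) ^ (-(1 / 2) : ℝ) with hr
  have hr0 : 0 < r := Real.rpow_pos_of_pos (by linarith) _
  have hrr : r ^ 2 = 1 / n := by
    rw [hr, ← Real.rpow_natCast, ← Real.rpow_mul (by positivity)]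
    norm_num
    rw [Real.rpow_neg_one]
  have htail := measure_errors_weighted_sum_ge (hε n) (hlaw n) (hind n)
    (f := fun x => x ^ 2 - t) (by fun_prop) hf h0 (1 / (n : ℝ)) (t := A * r) (by positivity)
  have hval : V * (n * (1 / (n : ℝ)) ^ 2) / (A * r) ^ 2 = V / A ^ 2 := by
    rw [mul_pow, hrr]
    field_simp
  rw [hval] at htail
  have hsplit : ENNReal.ofReal δ = ENNReal.ofReal (δ / 2) + ENNReal.ofReal (δ / 2) := by
    rw [← ENNReal.ofReal_add (by positivity) (by positivity), add_halves]
  rw [hsplit]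
  refine le_trans (measure_mono ?_) ((measure_union_le _ _).trans
    (add_le_add hbad (htail.trans (ENNReal.ofReal_le_ofReal hVA))))
  intro ω hω
  by_contra hgood
  simp only [Set.mem_union, Set.mem_ofPred_eq, not_or, not_lt, not_le] at hgood
  obtain ⟨g1, g2⟩ := hgood
  rw [← mean_sq_sub_eq (by omega) (fun i => ε n i ω) t] at g2
  set W := (∑ i, ε n i ω ^ 2) / n - t
  have hq := rpow_quarter_div_le hn
  have hm1 : r ≤ max r (s n * ℓ n / n) := le_max_left _ _
  have hm2 : s n * ℓ n / n ≤ max r (s n * ℓ n / n) := le_max_right _ _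
  set M := max r (s n * ℓ n / n)
  have h1 : |Z n ω| ≤ |Z n ω - W| + |W| := by
    have := abs_add_le (Z n ω - W) W
    rwa [sub_add_cancel] at this
  have h2 : K * ((n : ℝ) ^ (1 / 4 : ℝ) + s n) / n * |W| ≤ 1 * |W| :=
    mul_le_mul_of_nonneg_right hd (abs_nonneg _)
  have h3 : K * ((n : ℝ) ^ (1 / 4 : ℝ) + s n * ℓ n) / n ≤ K * (2 * M) := by
    rw [mul_div_assoc, add_div]
    exact mul_le_mul_of_nonneg_left (by linarith) hK
  have h4 : A * r ≤ A * M := mul_le_mul_of_nonneg_left hm1 hA0.le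
  have h5 : (2 * A + 2 * K) * M < |Z n ω| := hω
  linarith

theorem integral_sq_sub_sq (hmem : Integrable (fun x : ℝ => x ^ 4) ν)
    (hsq : Integrable (fun x : ℝ => x ^ 2) ν) (hvar : ∫ x, x ^ 2 ∂ν = t) :
    ∫ x, (x ^ 2 - t) ^ 2 ∂ν = ∫ x, x ^ 4 ∂ν - t ^ 2 := by
  have h : (fun x : ℝ => (x ^ 2 - t) ^ 2) = fun x => x ^ 4 - (2 * t * x ^ 2 - t ^ 2) := by
    ext x; ring
  have h1 : Integrable (fun x : ℝ => 2 * t * x ^ 2 - t ^ 2) ν :=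
    (hsq.const_mul _).sub (integrable_const _)
  rw [h, integral_sub hmem h1, integral_sub (hsq.const_mul _) (integrable_const _),
    integral_const_mul, hvar]
  simp
  ring

/-- The central limit theorem for row-wise i.i.d. arrays with a fixed law. -/
theorem tendstoInDistribution_array {f : ℝ → ℝ} (hε : ∀ n i, Measurable (ε n i))
    (hlaw : ∀ n i, μ.map (ε n i) = ν) (hind : ∀ n, iIndepFun (ε n) μ) (hfm : Measurable f)
    (hf : MemLp f 2 ν) (h0 : ∫ x, f x ∂ν = 0) :
    TendstoInDistribution (fun (n : ℕ) ω => (√n)⁻¹ * ∑ i, f (ε n i ω)) atTop (fun x : ℝ => x)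
      (fun _ => μ) (gaussianReal 0 (∫ x, f x ^ 2 ∂ν).toNNReal) := by
  -- The rows of the array have no prescribed joint law, while the central limit theorem concerns
  -- one infinite sequence. Convergence in distribution sees only the law of each row sum, so the
  -- rows may be replaced by initial segments of a single i.i.d. sequence.
  let P : Measure (ℕ → ℝ) := Measure.infinitePi fun _ => ν
  have hmp : ∀ i : ℕ, MeasurePreserving (fun ω : ℕ → ℝ => ω i) P ν := fun i =>
    ⟨measurable_pi_apply i, Measure.infinitePi_map_eval (fun _ => ν) i⟩
  have hint0 : ∫ ω, f (ω 0) ∂P = 0 := by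
    rw [← h0, ← (hmp 0).map_eq, integral_map (hmp 0).aemeasurable (by fun_prop)]
  have hmem : MemLp (fun ω : ℕ → ℝ => f (ω 0)) 2 P := hf.comp_measurePreserving (hmp 0)
  have hvar : Var[fun ω : ℕ → ℝ => f (ω 0); P] = ∫ x, f x ^ 2 ∂ν := by
    rw [variance_of_integral_eq_zero hmem.1.aemeasurable hint0, ← (hmp 0).map_eq,
      integral_map (hmp 0).aemeasurable (by fun_prop)]
  have hclt := tendstoInDistribution_inv_sqrt_mul_sum_sub (P := P)
    (P' := gaussianReal 0 (∫ x, f x ^ 2 ∂ν).toNNReal) (Y := fun x : ℝ => x)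
    (X := fun (i : ℕ) (ω : ℕ → ℝ) => f (ω i))
    (by rw [hvar]; exact ⟨by fun_prop, Measure.map_id⟩) hmem
    (iIndepFun_infinitePi fun _ => hfm) fun i =>
      ⟨(hfm.comp (measurable_pi_apply i)).aemeasurable,
        (hfm.comp (measurable_pi_apply 0)).aemeasurable, by
        rw [show (fun ω : ℕ → ℝ => f (ω i)) = f ∘ fun ω => ω i from rfl,
          show (fun ω : ℕ → ℝ => f (ω 0)) = f ∘ fun ω => ω 0 from rfl,
          ← Measure.map_map hfm (by fun_prop), ← Measure.map_map hfm (by fun_prop),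
          (hmp i).map_eq, (hmp 0).map_eq]⟩
  refine ⟨fun n => by fun_prop, by fun_prop, ?_⟩
  refine hclt.tendsto.congr fun n => ?_
  apply Subtype.ext
  change Measure.map _ P = Measure.map _ μ
  let g : (Fin n → ℝ) → ℝ := fun e => (√n)⁻¹ * ∑ i, f (e i)
  have hg : Measurable g := by fun_prop
  have h1 : (fun ω : ℕ → ℝ => (√n)⁻¹ * (∑ k ∈ Finset.range n, f (ω k) - n * ∫ ω, f (ω 0) ∂P)) =
      g ∘ fun ω (i : Fin n) => ω i := by
    ext ω
    rw [hint0, mul_zero, sub_zero, Finset.sum_range]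
    rfl
  have h2 : (fun ω => (√n)⁻¹ * ∑ i, f (ε n i ω)) = g ∘ fun ω i => ε n i ω := rfl
  have h3 : P.map (fun ω (i : Fin n) => ω i) = Measure.pi fun _ => ν := by
    rw [Measure.map_infinitePi_infinitePi_of_inj (P := fun _ : ℕ => ν) Fin.val_injective,
      Measure.infinitePi_eq_pi]
  rw [h1, h2, ← Measure.map_map hg (by fun_prop),
    ← Measure.map_map hg (measurable_pi_lambda _ (hε n)), h3,
    map_errors_eq_pi (hε n) (hlaw n) (hind n)]

/-- A variable close to the centred mean of the squared errors has its limit in distribution. -/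
theorem tendstoInDistribution_of_expansion (hε : ∀ n i, Measurable (ε n i))
    (hlaw : ∀ n i, μ.map (ε n i) = ν) (hind : ∀ n, iIndepFun (ε n) μ)
    (hf : MemLp (fun x : ℝ => x ^ 2 - t) 2 ν) (h0 : ∫ x, (x ^ 2 - t) ∂ν = 0)
    (hZ : ∀ n, Measurable (Z n)) (hs : Tendsto (fun n => s n / n) atTop (𝓝 0))
    (hsℓ : Tendsto (fun n : ℕ => s n * ℓ n / √n) atTop (𝓝 0))
    (h : Tendsto (fun n : ℕ => μ {ω |
      K * ((n : ℝ) ^ (1 / 4 : ℝ) + s n) / n * |(∑ i, ε n i ω ^ 2) / n - t| +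
        K * ((n : ℝ) ^ (1 / 4 : ℝ) + s n * ℓ n) / n <
      |Z n ω - ((∑ i, ε n i ω ^ 2) / n - t)|}) atTop (𝓝 0)) :
    TendstoInDistribution (fun (n : ℕ) ω => √n * Z n ω) atTop (fun x : ℝ => x)
      (fun _ => μ) (gaussianReal 0 (∫ x, (x ^ 2 - t) ^ 2 ∂ν).toNNReal) := by
  have hclt := tendstoInDistribution_array (f := fun x => x ^ 2 - t) hε hlaw hind (by fun_prop)
    hf h0
  -- Slutsky's argument: the difference is at most `d n * |√n W|`, small by Chebyshev as `d n` tends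
  -- to zero, plus the deterministic remainder `hrem`, where `s ℓ / √n → 0` enters.
  refine tendstoInDistribution_of_tendstoInMeasure_sub _ _ hclt ?_ fun n => by fun_prop
  rw [tendstoInMeasure_iff_dist]
  intro η hη
  set V := ∫ x, (x ^ 2 - t) ^ 2 ∂ν with hV
  set d : ℕ → ℝ := fun n => K * ((n : ℝ) ^ (1 / 4 : ℝ) + s n) / n with hd
  have hd0 : Tendsto d atTop (𝓝 0) := tendsto_rpow_quarter_add_div hs K
  have htail : ∀ n : ℕ, μ {ω | η / 2 ≤ |(d n / √n) * ∑ i, (ε n i ω ^ 2 - t)|} ≤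
      ENNReal.ofReal (V * (n * (d n / √n) ^ 2) / (η / 2) ^ 2) := fun n =>
    measure_errors_weighted_sum_ge (hε n) (hlaw n) (hind n) (f := fun x => x ^ 2 - t)
      (by fun_prop) hf h0 (d n / √n) (by positivity)
  have htaillim : Tendsto (fun n : ℕ =>
      ENNReal.ofReal (V * (n * (d n / √n) ^ 2) / (η / 2) ^ 2)) atTop (𝓝 0) := by
    rw [← ENNReal.ofReal_zero]
    refine ENNReal.tendsto_ofReal ?_
    have h1 : Tendsto (fun n => V * d n ^ 2 / (η / 2) ^ 2) atTop (𝓝 0) := by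
      simpa using ((hd0.pow 2).const_mul V).div_const ((η / 2) ^ 2)
    refine h1.congr' ?_
    filter_upwards [eventually_gt_atTop 0] with n hn
    have hn' : (0 : ℝ) < n := by exact_mod_cast hn
    rw [div_pow (d n), Real.sq_sqrt hn'.le, mul_div_cancel₀ _ hn'.ne']
  have hrem : Tendsto (fun n : ℕ => √n * (K * ((n : ℝ) ^ (1 / 4 : ℝ) + s n * ℓ n) / n))
      atTop (𝓝 0) := by
    have h1 : Tendsto (fun n : ℕ => (n : ℝ) ^ (1 / 4 : ℝ) / √n) atTop (𝓝 0) := by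
      refine (((tendsto_rpow_neg_atTop (y := 1 / 4) (by norm_num)).comp
        tendsto_natCast_atTop_atTop)).congr' ?_
      filter_upwards [eventually_gt_atTop 0] with n hn
      have hn' : (0 : ℝ) < n := by exact_mod_cast hn
      rw [Function.comp_apply, Real.sqrt_eq_rpow, ← Real.rpow_sub hn']
      norm_num
    have h2 := (h1.add hsℓ).const_mul K
    rw [add_zero, mul_zero] at h2
    refine h2.congr' ?_
    filter_upwards [eventually_gt_atTop 0] with n hn
    have hn' : (0 : ℝ) < n := by exact_mod_cast hn
    have h3 : √(n : ℝ) / n = 1 / √n := by rw [Real.sqrt_div_self', one_div]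
    calc K * ((n : ℝ) ^ (1 / 4 : ℝ) / √n + s n * ℓ n / √n)
        = K * ((n : ℝ) ^ (1 / 4 : ℝ) + s n * ℓ n) * (1 / √n) := by ring
      _ = _ := by rw [← h3]; ring
  have hsum := h.add htaillim
  rw [add_zero] at hsum
  refine tendsto_of_tendsto_of_tendsto_of_le_of_le' tendsto_const_nhds hsum
    (Eventually.of_forall fun _ => zero_le) ?_
  filter_upwards [eventually_gt_atTop 0, hrem.eventually_lt_const (half_pos hη)] with n hn hrn
  have hn' : (0 : ℝ) < n := by exact_mod_cast hn
  refine le_trans (measure_mono ?_) ((measure_union_le _ _).trans (add_le_add le_rfl (htail n)))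
  intro ω hω
  by_contra hgood
  simp only [Set.mem_union, Set.mem_ofPred_eq, not_or, not_lt, not_le] at hgood
  obtain ⟨g1, g2⟩ := hgood
  have hW := mean_sq_sub_eq hn (fun i => ε n i ω) t
  set S := ∑ i, (ε n i ω ^ 2 - t) with hS
  have hsqrt : 0 < √(n : ℝ) := Real.sqrt_pos.2 hn'
  have hnn : √(n : ℝ) * √n = n := Real.mul_self_sqrt hn'.le
  have hSW : (√n)⁻¹ * S = √n * ((∑ i, ε n i ω ^ 2) / n - t) := by
    rw [hW, one_div]
    nth_rewrite 3 [← hnn]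
    field_simp
  set W := (∑ i, ε n i ω ^ 2) / n - t
  have hω' : η ≤ |√n * Z n ω - (√n)⁻¹ * S| := by
    have : η ≤ dist (√n * Z n ω - (√n)⁻¹ * S) 0 := hω
    rwa [Real.dist_eq, sub_zero] at this
  rw [hSW, ← mul_sub, abs_mul, abs_of_pos hsqrt] at hω'
  have g3 := mul_le_mul_of_nonneg_left g1 hsqrt.le
  have h4 : √n * (d n * |W|) ≤ |d n / √n * S| := by
    have : d n / √n * S = d n * (√n * W) := by rw [← hSW]; ring
    rw [this, abs_mul, abs_mul, abs_of_pos hsqrt]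
    calc √n * (d n * |W|) ≤ √n * (|d n| * |W|) := by gcongr; exact le_abs_self _
      _ = _ := by ring
  rw [mul_add] at g3
  have h5 : √n * (d n * |W|) = √n * (K * ((n : ℝ) ^ (1 / 4 : ℝ) + s n) / n * |W|) := rfl
  linarith

end Limit

/-! ### Measurability and the main theorem -/

theorem measurable_plugInVariance {Ω : Type*} [MeasurableSpace Ω] {n p : ℕ}
    {X : Ω → Matrix (Fin n) (Fin p) ℝ} {y : Ω → Fin n → ℝ} {v : Ω → Fin p → ℝ}
    (hX : ∀ i j, Measurable fun ω => X ω i j) (hy : ∀ i, Measurable fun ω => y ω i)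
    (hv : Measurable v) : Measurable fun ω => plugInVariance (X ω) (y ω) (v ω) := by
  have hvj : ∀ j, Measurable fun ω => v ω j := fun j => (measurable_pi_apply j).comp hv
  have h1 : Measurable fun ω => (numNonzero (v ω) : ℝ) := by
    have : (fun ω => (numNonzero (v ω) : ℝ)) = fun ω => ∑ j, if v ω j ≠ 0 then (1 : ℝ) else 0 := by
      ext ω
      simp [numNonzero, Finset.card_filter]
    rw [this]
    refine Finset.measurable_sum _ fun j _ => Measurable.ite ?_ measurable_const measurable_const
    exact (hvj j (measurableSet_singleton 0)).compl
  unfold plugInVariance residualSS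
  simp only [Matrix.mulVec, dotProduct]
  fun_prop

theorem theorem3
    -- the law of the errors: mean zero, variance `σ ^ 2`, exponential moment
    (ν : Measure ℝ) [IsProbabilityMeasure ν] (σ a b : ℝ) (hσ : 0 ≤ σ)
    (hν_sq : MemLp (fun x : ℝ => x) 2 ν) (hν_mean : ∫ x, x ∂ν = 0)
    (hν_var : ∫ x, x ^ 2 ∂ν = σ ^ 2)
    (ha : 0 < a) (hb : 0 < b)
    (hν_exp : ∫⁻ x, ENNReal.ofReal (Real.exp (|x| / a)) ∂ν ≤ ENNReal.ofReal b)
    -- the constants that bound the entries and the sparse eigenvalues of the design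
    (L kmin kmax : ℝ) (hkmin : 0 < kmin) (hk : kmin ≤ kmax) :
    ∃ C₀ : ℝ, 0 < C₀ ∧
    ∀ {Ω : Type*} [MeasurableSpace Ω] (μ : Measure Ω) [IsProbabilityMeasure μ]
      -- the dimension, the coefficients, the errors and the design for each sample size `n`
      (p : ℕ → ℕ) (β : ∀ n, Fin (p n) → ℝ)
      (ε : ∀ n, Fin n → Ω → ℝ) (X : ∀ n, Ω → Matrix (Fin n) (Fin (p n)) ℝ),
      -- i.i.d. errors with law `ν`, independent of the design
      (∀ n i, Measurable (ε n i)) →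
      (∀ n i j, Measurable fun ω => X n ω i j) →
      (∀ n i, μ.map (ε n i) = ν) →
      (∀ n, iIndepFun (ε n) μ) →
      (∀ n, IndepFun (fun ω (i : Fin n) (j : Fin (p n)) => X n ω i j)
        (fun ω (i : Fin n) => ε n i ω) μ) →
      -- `φ_min(b_n) ≥ λ₀ > 0` with probability one for all `n`, for some `b_n = o(n)`
      (∃ (lam₀ : ℝ) (bseq : ℕ → ℕ), 0 < lam₀ ∧
        Tendsto (fun n => (bseq n : ℝ) / (n : ℝ)) atTop (𝓝 0) ∧
        ∀ n, 1 ≤ n → ∀ᵐ ω ∂μ, ENNReal.ofReal lam₀ ≤ phiMin (X n ω) (bseq n)) →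
      -- bounded entries
      (∀ n, ∀ᵐ ω ∂μ, ∀ i j, |X n ω i j| ≤ L) →
      -- sparse eigenvalues
      (∀ᵐ ω ∂μ, ENNReal.ofReal kmin ≤
        liminf (fun n : ℕ => phiMin (X n ω) ((numNonzero (β n) : ℝ) * Real.log n)) atTop) →
      (∀ᵐ ω ∂μ, limsup (fun n : ℕ =>
        phiMax (X n ω) ((numNonzero (β n) + min n (p n) : ℕ) : ℝ)) atTop ≤
          ENNReal.ofReal kmax) →
      -- sparsity
      (∃ α₀ : ℝ, α₀ < 1 ∧
        (fun n : ℕ => (numNonzero (β n) : ℝ)) =o[atTop] fun n : ℕ => (n : ℝ) ^ α₀) →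
      -- the LASSO estimator with `λ_n = c * σ * √(log p / n)`, `c ≥ C₀`
      ∀ c : ℝ, C₀ ≤ c →
      ∀ βhat : ∀ n, Ω → Fin (p n) → ℝ,
      (∀ n, Measurable (βhat n)) →
      (∀ n, ∀ᵐ ω ∂μ, IsLasso (X n ω) (fun i => (X n ω).mulVec (β n) i + ε n i ω)
        (c * σ * Real.sqrt (Real.log (p n) / n)) (βhat n ω)) →
      IsBigOInProb μ
        (fun n ω => plugInVariance (X n ω)
          (fun i => (X n ω).mulVec (β n) i + ε n i ω) (βhat n ω) - σ ^ 2)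
        (fun n => max ((n : ℝ) ^ (-(1 / 2) : ℝ))
          ((numNonzero (β n) : ℝ) * Real.log (p n) / n)) ∧
      (Tendsto (fun n : ℕ => (numNonzero (β n) : ℝ) * Real.log (p n) / Real.sqrt n)
          atTop (𝓝 0) →
        TendstoInDistribution
          (fun (n : ℕ) ω => Real.sqrt n * (plugInVariance (X n ω)
            (fun i => (X n ω).mulVec (β n) i + ε n i ω) (βhat n ω) - σ ^ 2))
          atTop (fun x : ℝ => x) (fun _ => μ)
          (gaussianReal 0 (Real.toNNReal (∫ x, x ^ 4 ∂ν - σ ^ 4)))) := by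
  have hkmax : 0 < kmax := hkmin.trans_le hk
  -- `L` may be zero or negative, and the Chernoff parameter divides by the bound on the entries;
  -- `|L| + 1` is a positive bound.
  have hL0 : (0 : ℝ) < |L| + 1 := by positivity
  set c₁ := 16 * a * (|L| + 1) * (1 + b) / σ with hc₁
  have hc₁0 : 0 ≤ c₁ := by positivity
  -- `c₁` serves the Chernoff bound, `8 √kmax` gives `c² ≥ 64 kmax` for the case `n < log p`, and 1
  -- ensures positivity. For `σ = 0` the division makes `c₁ = 0`, which is harmless as that case is
  -- treated apart.
  refine ⟨c₁ + 8 * √kmax + 1, by positivity, ?_⟩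
  intro Ω _ μ _ p β ε X hε hX hlaw hind hXε _ hbd hlow hup hsparse c hc βhat hβhat hlasso
  have hsqrt := Real.sqrt_nonneg kmax
  have hc0 : 0 < c := by linarith
  have hs : Tendsto (fun n => (numNonzero (β n) : ℝ) / n) atTop (𝓝 0) := by
    obtain ⟨α₀, hα₀, hs⟩ := hsparse
    exact tendsto_div_natCast_of_isLittleO_rpow hα₀.le hs
  obtain ⟨K, hK, hexp⟩ : ∃ K : ℝ, 0 ≤ K ∧ Tendsto (fun n : ℕ => μ {ω |
      K * ((n : ℝ) ^ (1 / 4 : ℝ) + numNonzero (β n)) / n *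
          |(∑ i, ε n i ω ^ 2) / n - σ ^ 2| +
        K * ((n : ℝ) ^ (1 / 4 : ℝ) + numNonzero (β n) * Real.log (p n)) / n <
      |plugInVariance (X n ω) (fun i => (X n ω).mulVec (β n) i + ε n i ω) (βhat n ω) - σ ^ 2 -
        ((∑ i, ε n i ω ^ 2) / n - σ ^ 2)|}) atTop (𝓝 0) := by
    -- In the noiseless case the expansion holds with `K = 0`: both of its sides vanish almost
    -- surely.
    rcases hσ.eq_or_lt with h0 | h0
    · refine ⟨0, le_rfl, tendsto_const_nhds.congr' ?_⟩
      filter_upwards [eventually_gt_atTop 0] with n hn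
      symm
      have hlasso' : ∀ᵐ ω ∂μ, IsLasso (X n ω) (fun i => (X n ω).mulVec (β n) i + ε n i ω) 0
          (βhat n ω) := by
        filter_upwards [hlasso n] with ω h1
        rwa [← h0, mul_zero, zero_mul] at h1
      have h1 := plugInVariance_expansion_noiseless hν_sq (by rw [hν_var, ← h0]; norm_num) hn
        (hε n) (hlaw n) hlasso'
      refine measure_mono_null ?_ (ae_iff.1 h1)
      rintro ω hω ⟨h2, h3⟩
      simp [h2, h3] at hω
    · refine tendsto_measure_plugInVariance_expansion h0 hν_sq hν_mean hν_var ha hb hν_exp hL0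
        hkmin hkmax hε hX hlaw hind hXε (fun n => ?_) hlow hup hs hc0 ?_ ?_ hlasso
      · filter_upwards [hbd n] with ω h1 i j
        exact (h1 i j).trans ((le_abs_self L).trans (by linarith))
      · have h1 : 16 * a * (|L| + 1) * (1 + b) = c₁ * σ := by
          rw [hc₁]
          field_simp
        rw [h1]
        exact mul_le_mul_of_nonneg_right (by linarith) hσ
      · have h1 : (8 * √kmax) ^ 2 ≤ c ^ 2 := pow_le_pow_left₀ (by positivity) (by linarith) 2
        rw [mul_pow, Real.sq_sqrt hkmax.le] at h1
        linarith
  have hf := memLp_sq_sub_of_exp ha hν_exp (σ ^ 2)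
  have hf0 := integral_sq_sub_eq_zero hν_sq hν_var
  refine ⟨isBigOInProb_of_expansion hε hlaw hind hf hf0 hK hs hexp, fun hsℓ => ?_⟩
  have hV := integral_sq_sub_sq (integrable_pow_of_exp ha hν_exp 4) hν_sq.integrable_sq hν_var
  rw [← pow_mul] at hV
  rw [← hV]
  refine tendstoInDistribution_of_expansion hε hlaw hind hf hf0 (fun n => ?_) hs hsℓ hexp
  refine (measurable_plugInVariance (hX n) (fun i => ?_) (hβhat n)).sub_const _
  have hXm := hX n
  have hεm := hε n
  simp only [Matrix.mulVec, dotProduct]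
  fun_prop
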